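/- **Model.** Let $G$ be a weighted undirected graph with $n\ge 2$ nodes (not necessarily connected). Fix a constant $a$; edge lengths are nonnegative integers at most $n^a$ and the nodes have distinct identifiers in $\{0,\dots,n^a-1\}$. $G$ is also the communication network. Every node knows $n$ and all other global parameters, its identifier, and the identifiers of its neighbours with the lengths of the connecting edges; all nodes run the same deterministic algorithm and local computation is free. A *step* is one of the following, where all transmitted words and all numbers that nodes supply (messages, delays, values) consist of $O(\log n)$ bits. 1. Every node sends one word to each of its neighbours. 2. A call of the distance oracle $\mathcal O^{Dist}_{\varepsilon,R}$ (precision parameter $\varepsilon$, distance parameter $R>0$) on a subgraph $H\subseteq G$, a set $S\subseteq V(H)$ and integer delays $\mathrm{del}(s)\ge 0$, $s\in S$. It returns some rooted forest $F\subseteq H$ with roots in $S$ such that $\mathrm{del}(\mathrm{root}_F(v))+d_F(\mathrm{root}_F(v),v)\le(1+\varepsilon)\,d_{H,\mathrm{del}}(S,v)$ for all $v\in V(F)$, and $v\in V(F)$ whenever $d_{H,\mathrm{del}}(S,v)\le R$; here $d_{H,\mathrm{del}}(S,v)=\min_{s\in S}(\mathrm{del}(s)+d_H(s,v))$. A node learns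 whether it is in $F$, and then its parent, its root and its distance to its root in $F$. 3. A call of the forest aggregation oracle with distance parameter $R>0$ on a rooted forest $F\subseteq G$, in which every node has distance at most $R$ to its root, and values $x_v$: each node of $F$ learns the sum of the values of its ancestors and of its descendants (itself included). 4. A call of the global aggregation oracle: all nodes learn $\sum_{v\in V(G)}x_v$. An algorithm solves a problem if, for every admissible behaviour of the oracles, all its calls are legal and its output is correct. A partition is output by every node giving the label of its cluster. The diameter of a partition is the maximum over its clusters $C$ of the diameter of the induced subgraph $G[C]$, and $B_G(v,D)=\{u: d_G(v,u)\le D\}$. Logarithms are to base $2$. **Theorem.** There is a deterministic algorithm which, given a global parameter $D>0$ and run on any such $G$, computes partitions $\mathcal C_1,\dots,\mathcal C_t$ of $V(G)$, for some $1\le t=O(\log n)$, such that each $\mathcal C_i$ has diameter $O(D\log^3 n)$ and for every node $v\in V(G)$ $$\bigl|\{i\in[t] : B_G(v,D)\subseteq C\text{ for some }C\in\mathcal C_i\}\bigr|\ \ge\ \tfrac{2t}{3}.$$ The algorithm takes $O(\log^4 n)$ steps; all its oracle calls have precision parameter $\varepsilon=1/\log^2 n$ and distance parameter at most $O(D\log^3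 n)$. All hidden constants depend only on $a$; in particular they do not depend on $D$. -/

import Mathlib

open scoped ENNReal

noncomputable section

namespace SparseCover

/-! ### Weighted graphs, distances, clusters -/

section Graphs

variable {V : Type*}

/-- `d_H(u, v)` for the edge lengths `len`: the least length of a walk of `H` from `u` to `v`,
and `∞` if there is none. -/
def wdist (H : SimpleGraph V) (len : Sym2 V → ℕ) (u v : V) : ℝ≥0∞ :=
  ⨅ p : H.Walk u v, (((p.edges.map len).sum : ℕ) : ℝ≥0∞)

/-- The closed ball `B_H(v, D)`. -/
def ball (H : SimpleGraph V) (len : Sym2 V → ℕ) (v : V) (D : ℝ) : Set V :=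
  {u | wdist H len v u ≤ ENNReal.ofReal D}

/-- The (strong) diameter of a cluster `C`, i.e. the diameter of the induced subgraph `H[C]`.
Distances of `H[C]` are measured in the graph on `V` whose edges are those of `H` inside `C`. -/
def strongDiam (H : SimpleGraph V) (len : Sym2 V → ℕ) (C : Set V) : ℝ≥0∞ :=
  ⨆ u ∈ C, ⨆ v ∈ C, wdist (H.induce C).spanningCoe len u v

/-- The partition of the vertices in which two vertices are in the same cluster
if and only if they have the same label. -/
def clusters (label : V → ℕ) : Set (Set V) := (Setoid.ker label).classes

/-- The partitions given by the labellings `label · i`, `i ∈ [t]`, all have (strong) diameter at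
most `Δ`, and every ball `B(v, D)` is inside one cluster in at least `2t/3` of them. -/
structure IsSparseCover (H : SimpleGraph V) (len : Sym2 V → ℕ) (D Δ : ℝ) {t : ℕ}
    (label : V → Fin t → ℕ) : Prop where
  diam_le : ∀ i, ∀ C ∈ clusters (fun v => label v i), strongDiam H len C ≤ ENNReal.ofReal Δ
  padded : ∀ v, 2 * t ≤
    3 * {i : Fin t | ∃ C ∈ clusters (fun u => label u i), ball H len v D ⊆ C}.ncard

/-- `d_{H,del}(S, v)`, the minimum over `s ∈ S` of `del(s) + d_H(s, v)`. Here `src s = some x` means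
`s ∈ S` and `del(s) = x`, while `src s = none` means `s ∉ S`. -/
def delayDist (H : SimpleGraph V) (len : Sym2 V → ℕ) (src : V → Option ℕ) (v : V) : ℝ≥0∞ :=
  ⨅ s : V, ⨅ x : ℕ, ⨅ _ : src s = some x, ((x : ℝ≥0∞) + wdist H len s v)

/-- Parent pointers of a rooted forest `F`: `none` at a vertex outside `V(F)`, `some none` at a root,
`some (some u)` at a vertex with parent `u`. -/
abbrev ParentMap (V : Type*) := V → Option (Option V)

/-- `RootPath len F v r d`: following parent pointers from `v` one ends at the root `r`, over a path
of length `d`; that is, `root_F(v) = r` and `d_F(v) = d`. -/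
inductive RootPath (len : Sym2 V → ℕ) (F : ParentMap V) : V → V → ℕ → Prop
  | root {v : V} : F v = some none → RootPath len F v v 0
  | step {v u r : V} {d : ℕ} : F v = some (some u) → RootPath len F u r d →
      RootPath len F v r (d + len s(v, u))

/-- `F` is a rooted forest and a subgraph of `H`: parents are `H`-neighbours, and every vertex of `F`
has a root (so there are no cycles). -/
structure IsForestIn (H : SimpleGraph V) (len : Sym2 V → ℕ) (F : ParentMap V) : Prop where
  adj : ∀ v u, F v = some (some u) → H.Adj v u
  exists_root : ∀ v, F v ≠ none → ∃ r d, RootPath len F v r d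

/-- The possible answers of the approximate distance oracle with precision parameter `ε` and distance
parameter `R` on the input `(H, S, del)`: any forest `F ⊆ H` rooted at a subset of `S` with
`del(root_F(v)) + d_F(v) ≤ (1 + ε) d_{H,del}(S, v)` for all `v ∈ V(F)`, containing all `v` with
`d_{H,del}(S, v) ≤ R`. -/
structure IsDistAnswer (H : SimpleGraph V) (len : Sym2 V → ℕ) (src : V → Option ℕ) (ε R : ℝ)
    (F : ParentMap V) : Prop where
  forest : IsForestIn H len F
  approx : ∀ v r d, RootPath len F v r d → ∃ x, src r = some x ∧
    ((x + d : ℕ) : ℝ≥0∞) ≤ ENNReal.ofReal (1 + ε) * delayDist H len src v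
  complete : ∀ v, delayDist H len src v ≤ ENNReal.ofReal R → F v ≠ none

/-- `u` is an ancestor of `v` in `F` (every vertex is an ancestor of itself). -/
def IsAncestor (F : ParentMap V) (u v : V) : Prop :=
  Relation.ReflTransGen (fun x y => F x = some (some y)) v u

end Graphs

/-! ### Networks and deterministic distributed algorithms with oracles -/

/-- A weighted graph that is also the communication network: edge lengths are nonnegative integers,
and the nodes have distinct identifiers. -/
structure Network (V : Type*) where
  graph : SimpleGraph V
  len : Sym2 V → ℕ
  id : V → ℕ
  id_injective : Function.Injective id

/-- Identifiers and edge lengths are at most polynomial: identifiers are below `n ^ a` and edge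
lengths at most `n ^ a`. -/
structure Network.PolyBounded {V : Type*} (N : Network V) (n a : ℕ) : Prop where
  id_lt : ∀ v, N.id v < n ^ a
  len_le : ∀ u v, N.graph.Adj u v → N.len s(u, v) ≤ n ^ a

open Classical in
/-- The neighbour of `v` with identifier `j`, if there is one. -/
def Network.nbr {V : Type*} (N : Network V) (v : V) (j : ℕ) : Option V :=
  if h : ∃ u, N.graph.Adj v u ∧ N.id u = j then some h.choose else none

theorem Network.nbr_eq_some_iff {V : Type*} (N : Network V) (v u : V) (j : ℕ) :
    N.nbr v j = some u ↔ N.graph.Adj v u ∧ N.id u = j := by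
  unfold Network.nbr
  split_ifs with h
  · constructor
    · intro hu
      have : h.choose = u := by simpa using hu
      exact this ▸ h.choose_spec
    · rintro ⟨_, hj⟩
      have : h.choose = u := N.id_injective (h.choose_spec.2.trans hj.symm)
      rw [this]
  · constructor
    · intro hu
      simp at hu
    · intro hu
      exact absurd ⟨u, hu⟩ h

/-- What a node `v ∈ V(F)` learns of the forest `F` returned by the distance oracle: the identifier of
its parent (`none` at a root), the identifier of `root_F(v)`, and the number `d_F(v)`. -/
structure ForestReply where
  parent : Option ℕ
  root : ℕ
  dist : ℕ

/-- One step, for nodes with states in `σ` and words in `{0, …, B - 1}`. Every ingredient is a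
function of the state of a single node, and neighbours are addressed by their identifiers.

* `exchange send recv`: a node in state `s` sends the word `send s j` to its neighbour with
  identifier `j`; then it updates its state by `recv`, which is given, for every `j`, the word
  received from the neighbour with identifier `j` (`none` if there is no such neighbour).
* `dist ε R keep src recv`: one call of the approximate distance oracle, with precision parameter `ε`
  and distance parameter `R`. An edge is in the input graph `H` if both endpoints keep it
  (`keep s j` for the edge to the neighbour with identifier `j`), a node is in the source set if `src`
  is not `none`, and then the value of `src` is its delay. A node outside the returned forest
  receives `none`.
* `forestAgg R par val recv`: one call of the forest aggregation oracle with distance parameter `R`.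
  The input is a rooted forest, given by the identifiers of parents (in the format of `ParentMap`),
  and a value at each node; a node receives the sum of the values of its ancestors and
  the sum of the values of its descendants.
* `globalAgg val recv`: one call of the global aggregation oracle; every node receives the sum of all
  the values. -/
inductive Instr (σ : Type) (B : ℕ) : Type
  | exchange (send : σ → ℕ → Fin B) (recv : σ → (ℕ → Option (Fin B)) → σ)
  | dist (ε R : ℝ) (keep : σ → ℕ → Bool) (src : σ → Option (Fin B))
      (recv : σ → Option ForestReply → σ)
  | forestAgg (R : ℝ) (par : σ → Option (Option ℕ)) (val : σ → Fin B) (recv : σ → ℕ → ℕ → σ)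
  | globalAgg (val : σ → Fin B) (recv : σ → ℕ → σ)

/-- All oracle calls have precision parameter `ε` and a positive distance parameter at most `R`. -/
def Instr.HasParams {σ : Type} {B : ℕ} (ε R : ℝ) : Instr σ B → Prop
  | .exchange _ _ => True
  | .dist ε' R' _ _ _ => ε' = ε ∧ 0 < R' ∧ R' ≤ R
  | .forestAgg R' _ _ _ => 0 < R' ∧ R' ≤ R
  | .globalAgg _ _ => True

section Semantics

variable {V : Type*} [Fintype V] {σ : Type} {B : ℕ}

/-- The subgraph of the network of the edges that both endpoints keep. (Vertices that are meant to be
outside the subgraph are isolated vertices and not sources.) -/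
def keptGraph (N : Network V) (keep : V → ℕ → Bool) : SimpleGraph V where
  Adj u v := N.graph.Adj u v ∧ keep u (N.id v) = true ∧ keep v (N.id u) = true
  symm := ⟨fun _ _ h => ⟨h.1.symm, h.2.2, h.2.1⟩⟩
  loopless := ⟨fun _ h => h.1.ne rfl⟩

open Classical in
/-- `I.Ensures N c post`: if the nodes are in the states `c`, then step `I` is legal, and the resulting
states satisfy `post`, whichever of its admissible answers the oracle gives. -/
def Instr.Ensures (N : Network V) (c : V → σ) (post : (V → σ) → Prop) : Instr σ B → Prop
  | .exchange send recv =>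
      post fun v => recv (c v) fun j => (N.nbr v j).map fun u => send (c u) (N.id v)
  | .dist ε R keep src recv =>
      ∀ (F : ParentMap V) (root : V → V) (d : V → ℕ),
        IsDistAnswer (keptGraph N fun v => keep (c v)) N.len
          (fun v => (src (c v)).map Fin.val) ε R F →
        (∀ v, F v ≠ none → RootPath N.len F v (root v) (d v)) →
        post fun v => recv (c v) <| (F v).map fun p =>
          { parent := p.map N.id, root := N.id (root v), dist := d v }
  | .forestAgg R par val recv =>
      ∃ F : ParentMap V, (∀ v, (F v).map (Option.map N.id) = par (c v)) ∧
        IsForestIn N.graph N.len F ∧ (∀ v r d, RootPath N.len F v r d → (d : ℝ) ≤ R) ∧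
        post fun v => recv (c v)
          (∑ u : V, if IsAncestor F u v then (val (c u) : ℕ) else 0)
          (∑ u : V, if IsAncestor F v u then (val (c u) : ℕ) else 0)
  | .globalAgg val recv => post fun v => recv (c v) (∑ u : V, (val (c u) : ℕ))

/-- The same for a sequence of steps. -/
def Ensures (N : Network V) (post : (V → σ) → Prop) : List (Instr σ B) → (V → σ) → Prop
  | [], c => post c
  | I :: l, c => I.Ensures N c fun c' => Ensures N post l c'

end Semantics

/-- A deterministic distributed algorithm with words in `{0, …, B - 1}`, run by all nodes.
Initially a node knows its identifier, the identifiers of its neighbours, and the lengths of its edges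
(`init` is given the identifier, and the function that sends `j` to the length of the edge to
the neighbour with identifier `j`). At the end it outputs `t` numbers. Local computation is
unrestricted. -/
structure Algorithm (B : ℕ) where
  State : Type
  init : ℕ → (ℕ → Option ℕ) → State
  steps : List (Instr State B)
  t : ℕ
  output : State → Fin t → ℕ

/-- The initial states of the nodes. -/
def Algorithm.start {B : ℕ} (A : Algorithm B) {V : Type*} (N : Network V) (v : V) : A.State :=
  A.init (N.id v) fun j => (N.nbr v j).map fun u => N.len s(v, u)

/-- On the network `N`, all oracle calls of the algorithm are legal and its output satisfies `P`, for
all admissible answers of the oracles. -/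
def Algorithm.Solves {B : ℕ} (A : Algorithm B) {V : Type*} [Fintype V] (N : Network V)
    (P : (V → Fin A.t → ℕ) → Prop) : Prop :=
  Ensures N (fun c => P fun v => A.output (c v)) A.steps (A.start N)

end SparseCover

end

/-! Let `L` be `log n` rounded up, and let identifiers have `b = O(L)` bits. Partitions are computed
one by one in `6 * L` rounds, coupled by multiplicative weights: every vertex starts with weight 1,
and its weight is doubled whenever its ball may have been cut. If a round cuts balls of at most a
tenth of the current weight, the total grows by a factor of at most `11/10`. As `2 * (11/10)^6 < 4`,
no vertex is hit more than `2 * L` times (`count_le`), a third of the rounds.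

A round refines the graph bit by bit. Initially every vertex is a terminal; before phase `i`,
terminals in one component agree on their first `i` bits and every vertex is near one of them
(`IsRuling`). Phase `i` grows an approximate shortest path forest from the terminals, giving those
with bit `i` set a delay `s`, and cuts the edges between trees whose roots differ in this bit.
Forest roots become the new terminals (`IsRuling.split`). After `b` phases each component has one
terminal, whose identifier is the cluster label.

The delay is found by pigeonhole. If a ball at `v` is endangered for delay `s`, then near `v` the
two kinds of terminals are almost balanced once `s` is added, up to the oracle error and `O(d)`.
This is `Conflict`, which does not mention the forest that the oracle chose. A vertex can be in
conflict for only one of several well separated delays (`Conflict.false_of_lt`), so among `10 * b`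
candidates one endangers at most a `1/(10 * b)` fraction of the weight, and a whole round at most a
tenth. Global aggregation detects such a delay deterministically.

The separation needed is `O(r / L^2 + d)` at terminal radius `r`, because `ε = O(1/L^2)`. Hence a
phase multiplies the radius by `1 + O(1/L)` and adds `O(L * d)`, and the final radius is `O(L^2 *
d)` (`exists_coverRadius_le`). The cases `D < 1` and bounded `n`, where these parameters fail, are
settled by the components of the short edges. -/

noncomputable section

namespace SparseCover

/-! ### Walks of bounded length -/

section Within

variable {V : Type*} {H G : SimpleGraph V} {len : Sym2 V → ℕ} {u v w : V} {k l : ℕ}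

/-- There is a walk of `H` from `u` to `v` of length at most `k`. -/
def Within (H : SimpleGraph V) (len : Sym2 V → ℕ) (k : ℕ) (u v : V) : Prop :=
  ∃ p : H.Walk u v, (p.edges.map len).sum ≤ k

theorem Within.refl (u : V) (k : ℕ) : Within H len k u u := ⟨.nil, by simp⟩

theorem Within.symm (h : Within H len k u v) : Within H len k v u := by
  obtain ⟨p, hp⟩ := h
  exact ⟨p.reverse, by simpa [List.sum_reverse] using hp⟩

theorem Within.trans (h : Within H len k u v) (h' : Within H len l v w) :
    Within H len (k + l) u w := by
  obtain ⟨p, hp⟩ := h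
  obtain ⟨q, hq⟩ := h'
  exact ⟨p.append q, by simpa [SimpleGraph.Walk.edges_append] using add_le_add hp hq⟩

theorem Within.mono (h : Within H len k u v) (hk : k ≤ l) : Within H len l u v :=
  h.imp fun _ hp => hp.trans hk

theorem Within.of_adj (h : H.Adj u v) : Within H len (len s(u, v)) u v :=
  ⟨.cons h .nil, by simp⟩

theorem Within.reachable (h : Within H len k u v) : H.Reachable u v := h.elim fun p _ => ⟨p⟩

/-- Lengths are integers, so a bound below `k + 1` already yields a walk of length at most `k`. The
strict form avoids arguing that the infimum is attained, and serves real radii through their floor.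
-/
theorem wdist_lt_succ_iff : wdist H len u v < (k : ℝ≥0∞) + 1 ↔ Within H len k u v := by
  unfold wdist Within
  rw [iInf_lt_iff]
  refine exists_congr fun p => ?_
  rw [← Nat.lt_succ_iff]
  exact_mod_cast Iff.rfl

theorem wdist_le_natCast_iff : wdist H len u v ≤ k ↔ Within H len k u v := by
  constructor
  · intro h
    exact wdist_lt_succ_iff.1 (h.trans_lt (by exact_mod_cast Nat.lt_succ_self k))
  · rintro ⟨p, hp⟩
    exact (iInf_le _ p).trans (by exact_mod_cast hp)

theorem wdist_le_ofReal_iff {D : ℝ} (hD : 0 ≤ D) :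
    wdist H len u v ≤ ENNReal.ofReal D ↔ Within H len ⌊D⌋₊ u v := by
  constructor
  · intro h
    refine wdist_lt_succ_iff.1 (h.trans_lt ?_)
    rw [ENNReal.ofReal_lt_iff_lt_toReal hD (by finiteness)]
    have := Nat.lt_floor_add_one D
    rw [ENNReal.toReal_add (by finiteness) (by finiteness)]
    simpa using this
  · intro h
    refine (wdist_le_natCast_iff.2 h).trans ?_
    rw [← ENNReal.ofReal_natCast]
    exact ENNReal.ofReal_le_ofReal (Nat.floor_le hD)

theorem mem_ball_iff {D : ℝ} (hD : 0 ≤ D) : u ∈ ball H len v D ↔ Within H len ⌊D⌋₊ v u :=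
  wdist_le_ofReal_iff hD

/-- A walk all whose edges stay in a set that is closed under adjacency is a walk of the
induced subgraph. -/
theorem Within.induce {C : Set V} (hH : H ≤ G) (hC : ∀ x y, H.Adj x y → x ∈ C → y ∈ C)
    (hu : u ∈ C) (h : Within H len k u v) : Within (G.induce C).spanningCoe len k u v := by
  obtain ⟨p, hp⟩ := h
  induction p generalizing k with
  | nil => exact .refl _ _
  | cons ha q ih =>
    have hb := hC _ _ ha hu
    simp only [SimpleGraph.Walk.edges_cons, List.map_cons, List.sum_cons] at hp
    refine ((Within.of_adj (len := len) ?_).trans (ih hb le_rfl)).mono hp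
    simpa [hu, hb] using hH ha

/-- Two walks from `r` are joined at `r`; a walk of `H` that starts in `C` cannot leave it, so it
survives in the induced subgraph. -/
theorem strongDiam_le {C : Set V} {r : V} (hH : H ≤ G)
    (hC : ∀ x y, H.Adj x y → x ∈ C → y ∈ C) (hr : ∀ v ∈ C, Within H len k r v) :
    strongDiam G len C ≤ ((2 * k : ℕ) : ℝ≥0∞) := by
  refine iSup₂_le fun x hx => iSup₂_le fun y hy => wdist_le_natCast_iff.2 ?_
  rw [two_mul]
  exact ((hr x hx).symm.trans (hr y hy)).induce hH hC hx

/-- Distances in a component are at most the number of vertices times the greatest edge length. -/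
theorem Within.of_reachable [Fintype V] {B : ℕ} (hB : ∀ x y, H.Adj x y → len s(x, y) ≤ B)
    (h : H.Reachable u v) : Within H len (Fintype.card V * B) u v := by
  classical
  obtain ⟨p, hp⟩ := h.exists_isPath
  refine ⟨p, ?_⟩
  have : ∀ e ∈ p.edges.map len, e ≤ B := by
    intro e he
    obtain ⟨e', he', rfl⟩ := List.mem_map.1 he
    have := p.edges_subset_edgeSet he'
    induction e' with
    | _ x y => exact hB x y this
  refine (List.sum_le_card_nsmul _ _ this).trans ?_
  simp only [List.length_map, SimpleGraph.Walk.length_edges, smul_eq_mul]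
  exact Nat.mul_le_mul_right _ hp.length_lt.le

/-- All edges on the walks of length at most `d` from `v` belong to `H`. -/
def KeepsBall (G H : SimpleGraph V) (len : Sym2 V → ℕ) (d : ℕ) (v : V) : Prop :=
  ∀ x y k, G.Adj x y → Within G len k y v → len s(x, y) + k ≤ d → H.Adj x y

/-- Every tail of a short walk ending at `v` is again a short walk ending at `v`, so each of its
edges is among those that `H` retains. -/
theorem KeepsBall.within {d : ℕ} (hv : KeepsBall G H len d v) (hk : k ≤ d)
    (h : Within G len k u v) : Within H len k u v := by
  obtain ⟨p, hp⟩ := h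
  induction p generalizing k with
  | nil => exact .refl _ _
  | cons ha q ih =>
    simp only [SimpleGraph.Walk.edges_cons, List.map_cons, List.sum_cons] at hp
    exact ((Within.of_adj (len := len) (hv _ _ _ ha ⟨q, le_rfl⟩ (hp.trans hk))).trans
      (ih hv (by omega) le_rfl)).mono hp

end Within

/-! ### Rooted forests and delayed distances -/

section Forests

variable {V : Type*} {H G : SimpleGraph V} {len : Sym2 V → ℕ} {F : ParentMap V}
  {u v r r' : V} {d d' : ℕ}

theorem RootPath.root_isRoot (h : RootPath len F v r d) : F r = some none := by
  induction h with
  | root h => exact h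
  | step _ _ ih => exact ih

theorem RootPath.unique (h : RootPath len F v r d) (h' : RootPath len F v r' d') :
    r = r' ∧ d = d' := by
  induction h generalizing d' with
  | root h =>
    cases h' with
    | root => exact ⟨rfl, rfl⟩
    | step h2 => simp [h] at h2
  | step h _ ih =>
    cases h' with
    | root h2 => simp [h] at h2
    | step h2 h3 =>
      obtain rfl : _ = _ := by simpa using h.symm.trans h2
      obtain ⟨rfl, rfl⟩ := ih h3
      exact ⟨rfl, rfl⟩

theorem RootPath.within (hF : ∀ v u, F v = some (some u) → H.Adj v u)
    (h : RootPath len F v r d) : Within H len d r v := by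
  induction h with
  | root => exact .refl _ _
  | step h _ ih =>
    have := Within.of_adj (len := len) (hF _ _ h).symm
    rw [Sym2.eq_swap] at this
    exact ih.trans this

theorem delayDist_le {src : V → Option ℕ} {x k : ℕ} (hs : src u = some x)
    (h : Within H len k u v) : delayDist H len src v ≤ ((x + k : ℕ) : ℝ≥0∞) := by
  refine (iInf_le_of_le u <| iInf_le_of_le x <| iInf_le_of_le hs le_rfl).trans ?_
  push_cast
  gcongr
  exact wdist_le_natCast_iff.2 h

/-- The oracle guarantee in the form used throughout: an inequality between finite numbers, tested
against any one source and any one walk from it. -/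
theorem IsDistAnswer.exists_src {src : V → Option ℕ} {ε R : ℝ} (hε : 0 ≤ ε)
    (h : IsDistAnswer H len src ε R F) (hv : RootPath len F v r d) :
    ∃ x, src r = some x ∧ ∀ s y k, src s = some y → Within H len k s v →
      ((x + d : ℕ) : ℝ) ≤ (1 + ε) * ((y + k : ℕ) : ℝ) := by
  obtain ⟨x, hx, hle⟩ := h.approx v r d hv
  refine ⟨x, hx, fun s y k hs hk => ?_⟩
  have h1 := hle.trans (mul_le_mul_right (delayDist_le hs hk) _)
  rw [← ENNReal.ofReal_natCast (y + k), ← ENNReal.ofReal_mul (by positivity),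
    ← ENNReal.ofReal_natCast] at h1
  exact (ENNReal.ofReal_le_ofReal_iff (by positivity)).1 h1

theorem IsDistAnswer.mem {src : V → Option ℕ} {ε R : ℝ} {x k : ℕ}
    (h : IsDistAnswer H len src ε R F) (hs : src u = some x) (hk : Within H len k u v)
    (hR : ((x + k : ℕ) : ℝ) ≤ R) : F v ≠ none := by
  refine h.complete v ((delayDist_le hs hk).trans ?_)
  rw [← ENNReal.ofReal_natCast]
  exact ENNReal.ofReal_le_ofReal hR

end Forests

/-! ### Splitting the clusters by one bit of the identifiers of their terminals -/

section Split

variable {V : Type*} {G H : SimpleGraph V} {len : Sym2 V → ℕ} {id : V → ℕ} {Q : V → Prop}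
  {i s R d : ℕ} {ε : ℝ} {F : ParentMap V} {root : V → V} {dF : V → ℕ}

/-- Every vertex `v` is within distance `R` of a terminal with identifier `rt v`, and terminals
in the same component agree on the first `i` bits of their identifiers. -/
structure IsRuling (H : SimpleGraph V) (len : Sym2 V → ℕ) (id : V → ℕ) (Q : V → Prop) (i R : ℕ)
    (rt : V → ℕ) : Prop where
  root : ∀ v, ∃ r, id r = rt v ∧ Q r ∧ Within H len R r v
  bits : ∀ q q', Q q → Q q' → H.Reachable q q' → ∀ j < i, (id q).testBit j = (id q').testBit j

/-- The edges of `H` whose endpoints have the same colour. -/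
def cutGraph (H : SimpleGraph V) (col : V → Bool) : SimpleGraph V where
  Adj u v := H.Adj u v ∧ col u = col v
  symm := ⟨fun _ _ h => ⟨h.1.symm, h.2.symm⟩⟩
  loopless := ⟨fun _ h => h.1.ne rfl⟩

theorem cutGraph_le (H : SimpleGraph V) (col : V → Bool) : cutGraph H col ≤ H := fun _ _ h => h.1

theorem color_eq_of_reachable {col : V → Bool} {u v : V} (h : (cutGraph H col).Reachable u v) :
    col u = col v := by
  obtain ⟨p⟩ := h
  induction p with
  | nil => rfl
  | cons h _ ih => exact h.2.trans ih

open Classical in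
/-- Terminals whose `i`-th bit is set start with delay `s`, the other ones with delay `0`. -/
def splitSrc (id : V → ℕ) (Q : V → Prop) (i s : ℕ) (v : V) : Option ℕ :=
  if Q v then some (if (id v).testBit i then s else 0) else none

theorem splitSrc_eq_some_iff {v : V} {x : ℕ} : splitSrc id Q i s v = some x ↔
    Q v ∧ x = if (id v).testBit i then s else 0 := by
  unfold splitSrc
  by_cases h : Q v
  · rw [if_pos h, Option.some_inj, eq_comm]
    exact (and_iff_right h).symm
  · simp [h]

theorem splitSrc_le {v : V} {x : ℕ} (h : splitSrc id Q i s v = some x) : x ≤ s := by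
  rw [splitSrc_eq_some_iff] at h
  rw [h.2]
  split_ifs <;> omega

/-- The bit of the root decides the side of a vertex. -/
def side (id : V → ℕ) (i : ℕ) (root : V → V) (v : V) : Bool := (id (root v)).testBit i

theorem IsRuling.mem_forest {R' : ℝ} {rt : V → ℕ} (hinv : IsRuling H len id Q i R rt)
    (hF : IsDistAnswer H len (splitSrc id Q i s) ε R' F) (hR : ((R + s : ℕ) : ℝ) ≤ R') (v : V) :
    F v ≠ none := by
  obtain ⟨r, -, hr, hw⟩ := hinv.root v
  refine hF.mem (splitSrc_eq_some_iff.2 ⟨hr, rfl⟩) hw (le_trans ?_ hR)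
  have := splitSrc_le (splitSrc_eq_some_iff.2 ⟨hr, rfl⟩ : splitSrc id Q i s r = some _)
  exact_mod_cast (by omega)

/-- The root is constant along tree paths, so these are monochromatic and survive the cut;
comparison with the old terminal within `R` bounds their length. Roots in one remaining component
have the same colour, which is their bit `i`; being old terminals, they still agree on the earlier
bits. -/
theorem IsRuling.split {R' : ℝ} {R₂ : ℕ} {rt : V → ℕ} (hinv : IsRuling H len id Q i R rt)
    (hε : 0 ≤ ε) (hF : IsDistAnswer H len (splitSrc id Q i s) ε R' F)
    (hroot : ∀ v, F v ≠ none → RootPath len F v (root v) (dF v))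
    (hR : ((R + s : ℕ) : ℝ) ≤ R') (hR₂ : (1 + ε) * ((R + s : ℕ) : ℝ) ≤ R₂) :
    IsRuling (cutGraph H (side id i root)) len id (fun v => F v = some none) (i + 1) R₂
      (fun v => id (root v)) := by
  have hmem := hinv.mem_forest hF hR
  have hcol : ∀ v u, F v = some (some u) → root v = root u := fun v u h =>
    ((hroot v (hmem v)).unique (.step h (hroot u (hmem u)))).1
  have hself : ∀ v, F v = some none → root v = v := fun v h =>
    ((hroot v (hmem v)).unique (.root h)).1
  refine ⟨fun v => ⟨root v, rfl, (hroot v (hmem v)).root_isRoot, ?_⟩, fun q q' hq hq' hr j hj => ?_⟩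
  · have hw : Within (cutGraph H (side id i root)) len (dF v) (root v) v :=
      (hroot v (hmem v)).within fun x y h => ⟨hF.forest.adj x y h, by rw [side, side, hcol x y h]⟩
    refine hw.mono ?_
    obtain ⟨x, hx, hle⟩ := hF.exists_src hε (hroot v (hmem v))
    obtain ⟨r, -, hr, hw'⟩ := hinv.root v
    have h1 := hle r _ R (splitSrc_eq_some_iff.2 ⟨hr, rfl⟩) hw'
    have h2 := splitSrc_le (splitSrc_eq_some_iff.2 ⟨hr, rfl⟩ : splitSrc id Q i s r = some _)
    have h3 : ((x + dF v : ℕ) : ℝ) ≤ R₂ := by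
      refine h1.trans (le_trans ?_ hR₂)
      rw [add_comm R s]
      gcongr
    have : x + dF v ≤ R₂ := by exact_mod_cast h3
    omega
  · rcases Nat.lt_succ_iff_lt_or_eq.1 hj with hj | rfl
    · have hQ : ∀ q, F q = some none → Q q := fun q h => by
        obtain ⟨x, hx, -⟩ := hF.exists_src hε (.root h)
        exact (splitSrc_eq_some_iff.1 hx).1
      exact hinv.bits q q' (hQ q hq) (hQ q' hq') (hr.mono (cutGraph_le _ _)) j hj
    · simpa [side, hself q hq, hself q' hq'] using color_eq_of_reachable hr

/-- Near `v` there are a vertex at which the delay `s` is too large for the terminals with the bit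
to prevail clearly, and one at which it is too small for the other ones to prevail clearly. -/
def Conflict (H : SimpleGraph V) (len : Sym2 V → ℕ) (id : V → ℕ) (Q : V → Prop) (i R d : ℕ) (ε : ℝ)
    (s : ℕ) (v : V) : Prop :=
  (∃ x q a, Within H len (3 * d) x v ∧ Q q ∧ (id q).testBit i = false ∧ Within H len a q x ∧
    ∀ q' k, Q q' → (id q').testBit i = true → Within H len k q' x →
      (a : ℝ) ≤ (1 + ε) * (s + k)) ∧
  ∃ y q a, Within H len (3 * d) y v ∧ Q q ∧ (id q).testBit i = true ∧ Within H len a q y ∧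
    (a + s : ℝ) ≤ (1 + ε) * (R + s) ∧
    ∀ q' k, Q q' → (id q').testBit i = false → Within H len k q' y → (a + s : ℝ) ≤ (1 + ε) * k

/-- Each endpoint of the cut edge supplies one half of the conflict: the oracle preferred its root
to all terminals of the other kind. The edge adds `d` to the distance `2 * d`, whence `3 * d`. -/
theorem conflict_of_within {R' : ℝ} {rt : V → ℕ} {x y v : V} (hinv : IsRuling H len id Q i R rt)
    (hε : 0 ≤ ε) (hF : IsDistAnswer H len (splitSrc id Q i s) ε R' F)
    (hroot : ∀ v, F v ≠ none → RootPath len F v (root v) (dF v))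
    (hR : ((R + s : ℕ) : ℝ) ≤ R') (hxy : H.Adj x y) (hne : side id i root x ≠ side id i root y)
    (hd : len s(x, y) ≤ d) (hv : Within H len (2 * d) x v) :
    Conflict H len id Q i R d ε s v := by
  have hmem := hinv.mem_forest hF hR
  have hw : ∀ x, Within H len (dF x) (root x) x := fun x =>
    (hroot x (hmem x)).within hF.forest.adj
  have hx3 : Within H len (3 * d) x v := hv.mono (by omega)
  have hy3 : Within H len (3 * d) y v :=
    ((Within.of_adj (len := len) hxy).symm.trans hv).mono (by omega)
  have hblue : ∀ x, Within H len (3 * d) x v → side id i root x = false →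
      ∃ x q a, Within H len (3 * d) x v ∧ Q q ∧ (id q).testBit i = false ∧ Within H len a q x ∧
        ∀ q' k, Q q' → (id q').testBit i = true → Within H len k q' x →
        (a : ℝ) ≤ (1 + ε) * (s + k) := by
    intro x hx hc
    obtain ⟨z, hz, hle⟩ := hF.exists_src hε (hroot x (hmem x))
    rw [splitSrc_eq_some_iff] at hz
    refine ⟨x, root x, dF x, hx, hz.1, hc, hw x, fun q' k hq' hb hk => ?_⟩
    have := hle q' s k (splitSrc_eq_some_iff.2 ⟨hq', by simp [hb]⟩) hk
    have hz2 : (0 : ℝ) ≤ z := by positivity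
    push_cast at this
    linarith
  have hred : ∀ y, Within H len (3 * d) y v → side id i root y = true →
      ∃ y q a, Within H len (3 * d) y v ∧ Q q ∧ (id q).testBit i = true ∧ Within H len a q y ∧
        (a + s : ℝ) ≤ (1 + ε) * (R + s) ∧
        ∀ q' k, Q q' → (id q').testBit i = false → Within H len k q' y →
        (a + s : ℝ) ≤ (1 + ε) * k := by
    intro y hy hc
    obtain ⟨z, hz, hle⟩ := hF.exists_src hε (hroot y (hmem y))
    rw [splitSrc_eq_some_iff] at hz
    have hzs : z = s := by rw [hz.2]; exact if_pos hc
    subst hzs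
    refine ⟨y, root y, dF y, hy, hz.1, hc, hw y, ?_, fun q' k hq' hb hk => ?_⟩
    · obtain ⟨r, -, hr, hwr⟩ := hinv.root y
      have h1 := hle r _ R (splitSrc_eq_some_iff.2 ⟨hr, rfl⟩) hwr
      have h2 := splitSrc_le (splitSrc_eq_some_iff.2 ⟨hr, rfl⟩ : splitSrc id Q i z r = some _)
      have h3 : (1 + ε) * (((if (id r).testBit i then z else 0) + R : ℕ) : ℝ)
          ≤ (1 + ε) * (R + z) := by
        gcongr
        exact_mod_cast (by omega)
      push_cast at h1 h3
      linarith
    · have := hle q' 0 k (splitSrc_eq_some_iff.2 ⟨hq', by simp [hb]⟩) hk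
      push_cast at this
      linarith
  cases hc : side id i root x
  · have hc' : side id i root y = true := by simpa [hc] using hne.symm
    exact ⟨hblue x hx3 hc, hred y hy3 hc'⟩
  · have hc' : side id i root y = false := by simpa [hc] using hne.symm
    exact ⟨hblue y hy3 hc', hred x hx3 hc⟩

/-- A vertex is in conflict for at most one of several delays that are sufficiently far apart. -/
theorem Conflict.false_of_lt {s' : ℕ} {v : V} (hε : 0 ≤ ε) (hε1 : ε ≤ 1)
    (h : Conflict H len id Q i R d ε s v) (h' : Conflict H len id Q i R d ε s' v)
    (hs : s + (6 * ε * (R + s') + 36 * d) < s') : False := by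
  obtain ⟨⟨x, q, a, hx, hq, hqb, hqx, hle⟩, -⟩ := h
  obtain ⟨-, y, q', a', hy, hq', hqb', hqy, hR, hle'⟩ := h'
  -- The two witnesses are compared through `v`, at a detour of `6 * d`: the unset terminal that won
  -- under `s` and the set terminal that won under `s'`.
  have h1 := hle q' (a' + (3 * d + 3 * d)) hq' hqb' (hqy.trans (hy.trans hx.symm))
  have h2 := hle' q (a + (3 * d + 3 * d)) hq hqb (hqx.trans (hx.trans hy.symm))
  push_cast at h1 h2
  have ha : (0 : ℝ) ≤ a' := by positivity
  have hd : (0 : ℝ) ≤ d := by positivity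
  have hs0 : (0 : ℝ) ≤ s := by positivity
  have hs'0 : (0 : ℝ) ≤ s' := by positivity
  have hR0 : (0 : ℝ) ≤ R := by positivity
  -- Substituting one comparison into the other costs `(1 + ε)^2`. As `ε ≤ 1`, the excess is at most
  -- `3 * ε * (s + a') + (24 + 12) * d`, and `s + a'` is at most `2 * (R + s')`.
  have h3 : (a' : ℝ) + s' ≤ (1 + ε) * ((1 + ε) * (s + (a' + (3 * d + 3 * d))) + 6 * d) := by
    refine h2.trans ?_
    gcongr
    linarith
  have h4 : (a' : ℝ) + s' ≤ 2 * (R + s') := hR.trans (by gcongr; linarith)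
  have h5 : ε * ε ≤ ε := by nlinarith
  have hss : (s : ℝ) ≤ s' := by nlinarith [mul_nonneg hε (add_nonneg hR0 hs'0)]
  have h6 : ε * (s + a') ≤ ε * (2 * (R + s')) := by gcongr; linarith
  have h7 : ε * ε * (s + a') ≤ ε * (s + a') := by gcongr
  have h8 : ε * ε * d ≤ d := by nlinarith
  have h9 : ε * d ≤ d := by nlinarith
  nlinarith

/-- An edge of the ball that gets cut would be a short two-coloured edge with an endpoint within `d`
of `v`, measured already in `H`. This is why it suffices to detect boundaries in the current graph.
-/
theorem KeepsBall.cut {col : V → Bool} {v : V} (hv : KeepsBall G H len d v)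
    (hcol : ∀ x y, H.Adj x y → col x ≠ col y → len s(x, y) ≤ d → ¬ Within H len d x v) :
    KeepsBall G (cutGraph H col) len d v := by
  intro x y k hxy hk hle
  have hH := hv x y k hxy hk hle
  refine ⟨hH, ?_⟩
  by_contra hne
  refine hcol y x hH.symm (Ne.symm hne) ?_ ((hv.within (by omega) hk).mono (by omega))
  rw [Sym2.eq_swap]
  omega

end Split

/-- What the answer of the distance oracle tells about the vertices near a set `S`. -/
theorem IsDistAnswer.near {V : Type*} {H : SimpleGraph V} {len : Sym2 V → ℕ} {S : V → Prop}
    {src : V → Option ℕ} (hsrc : ∀ v x, src v = some x ↔ S v ∧ x = 0)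
    {ε : ℝ} {d : ℕ} {F : ParentMap V} {root : V → V} {dF : V → ℕ} (hε : 0 ≤ ε) (hε1 : ε ≤ 1)
    (hF : IsDistAnswer H len src ε d F)
    (hroot : ∀ v, F v ≠ none → RootPath len F v (root v) (dF v)) (v : V) :
    ((F v ≠ none ∧ dF v ≤ 2 * d) → ∃ x, S x ∧ Within H len (2 * d) x v) ∧
    (¬ (F v ≠ none ∧ dF v ≤ 2 * d) → ∀ x, S x → ¬ Within H len d x v) := by
  constructor
  · rintro ⟨h1, h2⟩
    obtain ⟨x, hx, -⟩ := hF.exists_src hε (hroot v h1)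
    exact ⟨root v, ((hsrc _ _).1 hx).1, ((hroot v h1).within hF.forest.adj).mono h2⟩
  · intro h x hx hw
    have hm : F v ≠ none := hF.mem ((hsrc _ _).2 ⟨hx, rfl⟩) hw (by simp)
    refine h ⟨hm, ?_⟩
    obtain ⟨z, -, hle⟩ := hF.exists_src hε (hroot v hm)
    have := hle x 0 d ((hsrc _ _).2 ⟨hx, rfl⟩) hw
    have h2 : ((z + dF v : ℕ) : ℝ) ≤ (2 * d : ℕ) := by
      refine this.trans ?_
      push_cast
      nlinarith [(Nat.cast_nonneg d : (0 : ℝ) ≤ d)]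
    have : z + dF v ≤ 2 * d := by exact_mod_cast h2
    omega

/-! ### Clusters given by labels -/

section Labels

variable {V : Type*} {G H : SimpleGraph V} {len : Sym2 V → ℕ} {label : V → ℕ}

theorem cluster_mem (label : V → ℕ) (v : V) : {u | label u = label v} ∈ clusters label :=
  ⟨v, rfl⟩

theorem exists_eq_of_mem_clusters {C : Set V} (h : C ∈ clusters label) :
    ∃ v, C = {u | label u = label v} := by
  obtain ⟨v, rfl⟩ := h
  exact ⟨v, rfl⟩

theorem label_eq_of_reachable (hadj : ∀ x y, H.Adj x y → label x = label y) {u v : V}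
    (h : H.Reachable u v) : label u = label v := by
  obtain ⟨p⟩ := h
  induction p with
  | nil => rfl
  | cons h _ ih => exact (hadj _ _ h).trans ih

/-- Injectivity of the identifiers turns a common label into a common centre. -/
theorem strongDiam_cluster_le {id : V → ℕ} (hid : Function.Injective id) {R : ℕ} (hH : H ≤ G)
    (hadj : ∀ x y, H.Adj x y → label x = label y)
    (hroot : ∀ v, ∃ r, id r = label v ∧ Within H len R r v) {C : Set V} (hC : C ∈ clusters label) :
    strongDiam G len C ≤ ((2 * R : ℕ) : ℝ≥0∞) := by
  obtain ⟨v, rfl⟩ := exists_eq_of_mem_clusters hC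
  obtain ⟨r, hr, -⟩ := hroot v
  refine strongDiam_le (r := r) hH (fun x y h hx => (hadj x y h).symm.trans hx) fun u hu => ?_
  obtain ⟨r', hr', hw⟩ := hroot u
  obtain rfl : r' = r := hid (hr'.trans (Eq.trans hu hr.symm))
  exact hw

theorem KeepsBall.ball_subset {D : ℝ} (hD : 0 ≤ D) {v : V}
    (hadj : ∀ x y, H.Adj x y → label x = label y) (hv : KeepsBall G H len ⌊D⌋₊ v) :
    ball G len v D ⊆ {u | label u = label v} := fun _ hu =>
  label_eq_of_reachable hadj (hv.within le_rfl ((mem_ball_iff hD).1 hu).symm).reachable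

end Labels

/-! ### Reasoning about sequences of steps -/

section Logic

variable {V : Type*} [Fintype V] {σ : Type} {B : ℕ} {N : Network V} {post post' : (V → σ) → Prop}

theorem Instr.Ensures.mono {I : Instr σ B} {c : V → σ} (h : I.Ensures N c post)
    (hp : ∀ c, post c → post' c) : I.Ensures N c post' := by
  cases I with
  | exchange => exact hp _ h
  | dist => exact fun F root d h1 h2 => hp _ (h F root d h1 h2)
  | forestAgg => exact h.imp fun F hF => ⟨hF.1, hF.2.1, hF.2.2.1, hp _ hF.2.2.2⟩
  | globalAgg => exact hp _ h

theorem Ensures.mono {l : List (Instr σ B)} {c : V → σ} (h : Ensures N post l c)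
    (hp : ∀ c, post c → post' c) : Ensures N post' l c := by
  induction l generalizing c with
  | nil => exact hp _ h
  | cons I l ih => exact Instr.Ensures.mono h fun c' hc' => ih hc'

theorem ensures_append (l l' : List (Instr σ B)) (c : V → σ) :
    Ensures N post (l ++ l') c ↔ Ensures N (Ensures N post l') l c := by
  induction l generalizing c with
  | nil => rfl
  | cons I l ih => simp only [List.cons_append, Ensures, ih]

/-- The steps `body 0`, `body 1`, …, `body (k - 1)` one after another. -/
def loop (k : ℕ) (body : ℕ → List (Instr σ B)) : List (Instr σ B) := (List.range k).flatMap body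

theorem ensures_loop {k : ℕ} {body : ℕ → List (Instr σ B)} (inv : ℕ → (V → σ) → Prop)
    (hinv : ∀ i < k, ∀ c, inv i c → Ensures N (inv (i + 1)) (body i) c) {c : V → σ}
    (hc : inv 0 c) : Ensures N (inv k) (loop k body) c := by
  induction k with
  | zero => exact hc
  | succ k ih =>
    rw [loop, List.range_succ, List.flatMap_append, ensures_append]
    refine (ih fun i hi => hinv i (by omega)).mono fun c' hc' => ?_
    simpa using hinv k (by omega) c' hc'

theorem length_loop {k m : ℕ} {body : ℕ → List (Instr σ B)} (h : ∀ i, (body i).length = m) :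
    (loop k body).length = k * m := by
  simp [loop, List.length_flatMap, h]

theorem mem_loop {k : ℕ} {body : ℕ → List (Instr σ B)} {I : Instr σ B} :
    I ∈ loop k body ↔ ∃ i < k, I ∈ body i := by
  simp [loop]

end Logic

theorem keptGraph_adj {V : Type*} {N : Network V} {keep : V → ℕ → Bool} {u v : V} :
    (keptGraph N keep).Adj u v ↔
      N.graph.Adj u v ∧ keep u (N.id v) = true ∧ keep v (N.id u) = true := Iff.rfl

theorem Network.nbr_id {V : Type*} (N : Network V) {u v : V} (h : N.graph.Adj v u) :
    N.nbr v (N.id u) = some u := (N.nbr_eq_some_iff v u _).2 ⟨h, rfl⟩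

/-- The lengths of the edges at `v`, as known to `v`. -/
def Network.nbrLen {V : Type*} (N : Network V) (v : V) (j : ℕ) : Option ℕ :=
  (N.nbr v j).map fun u => N.len s(v, u)

theorem Network.nbrLen_id {V : Type*} (N : Network V) {u v : V} (h : N.graph.Adj v u) :
    N.nbrLen v (N.id u) = some (N.len s(v, u)) := by simp [Network.nbrLen, N.nbr_id h]

theorem map_val_eq_some_iff {B x : ℕ} {P : Prop} [Decidable P] (hB : 0 < B) :
    (if P then some (⟨0, hB⟩ : Fin B) else none).map Fin.val = some x ↔ P ∧ x = 0 := by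
  by_cases h : P
  · rw [if_pos h, Option.map_some, Option.some_inj, and_iff_right h, eq_comm]
  · simp [h]

/-! ### Components of the graph of the short edges -/

section Components

/-- The edges of length at most `δ`. -/
def lightGraph {V : Type*} (G : SimpleGraph V) (len : Sym2 V → ℕ) (δ : ℕ) : SimpleGraph V where
  Adj u v := G.Adj u v ∧ len s(u, v) ≤ δ
  symm := ⟨fun _ _ h => ⟨h.1.symm, Sym2.eq_swap ▸ h.2⟩⟩
  loopless := ⟨fun _ h => h.1.ne rfl⟩

structure CompState where
  id : ℕ
  nlen : ℕ → Option ℕ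
  cand : Bool
  root : ℕ

def CompState.light (δ : ℕ) (s : CompState) (j : ℕ) : Bool := (s.nlen j).any fun l => l ≤ δ

variable {B : ℕ} (hB : 0 < B) (ε R : ℝ) (δ : ℕ)

/-- In components with a candidate whose `i`-th bit is not set, only such candidates stay. -/
def compStep (i : ℕ) : Instr CompState B :=
  .dist ε R (CompState.light δ) (fun s => if s.cand && !s.id.testBit i then some ⟨0, hB⟩ else none)
    fun s r => { s with cand := s.cand && (r.isNone || !s.id.testBit i) }

/-- All vertices learn the identifier of the remaining candidate of their component. -/
def compFinish : Instr CompState B :=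
  .dist ε R (CompState.light δ) (fun s => if s.cand then some ⟨0, hB⟩ else none)
    fun s r => { s with root := (r.map ForestReply.root).getD 0 }

/-- Partition into the components of the graph of the edges of length at most `δ`, when the
identifiers have `b` bits. -/
def compAlgorithm (b : ℕ) : Algorithm B where
  State := CompState
  init id nlen := ⟨id, nlen, true, 0⟩
  steps := loop b (fun i => [compStep hB ε R δ i]) ++ [compFinish hB ε R δ]
  t := 1
  output s _ := s.root

variable {hB ε R δ} {V : Type*} {N : Network V}

/-- The candidates after `i` steps. -/
structure CompInv (N : Network V) (δ i : ℕ) (c : V → CompState) : Prop where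
  id : ∀ v, (c v).id = N.id v
  nlen : ∀ v, (c v).nlen = N.nbrLen v
  exists_cand : ∀ v, ∃ u, (c u).cand = true ∧ (lightGraph N.graph N.len δ).Reachable u v
  bits : ∀ u v, (c u).cand = true → (c v).cand = true →
    (lightGraph N.graph N.len δ).Reachable u v → ∀ j < i, (N.id u).testBit j = (N.id v).testBit j

theorem CompInv.keptGraph_eq {i : ℕ} {c : V → CompState} (h : CompInv N δ i c) :
    keptGraph N (fun v => (c v).light δ) = lightGraph N.graph N.len δ := by
  ext u v
  rw [keptGraph_adj]
  refine and_congr_right fun ha => ?_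
  simp only [CompState.light, h.nlen, N.nbrLen_id ha, N.nbrLen_id ha.symm]
  rw [Sym2.eq_swap (a := v)]
  simp

/-- `R` exceeds all distances inside components, so the oracle acts as an exact connectivity test.
-/
theorem mem_forest_iff [Fintype V] {S : V → Prop} {src : V → Option ℕ} (hε : 0 ≤ ε)
    (hR : ((Fintype.card V * δ : ℕ) : ℝ) ≤ R) (hsrc : ∀ v x, src v = some x ↔ S v ∧ x = 0)
    {F : ParentMap V} (hF : IsDistAnswer (lightGraph N.graph N.len δ) N.len src ε R F) (v : V) :
    F v ≠ none ↔ ∃ u, S u ∧ (lightGraph N.graph N.len δ).Reachable u v := by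
  constructor
  · intro h
    obtain ⟨r, d, hr⟩ := hF.forest.exists_root v h
    obtain ⟨x, hx, -⟩ := hF.exists_src hε hr
    exact ⟨r, ((hsrc _ _).1 hx).1, (hr.within hF.forest.adj).reachable⟩
  · rintro ⟨u, hu, hr⟩
    exact hF.mem ((hsrc _ _).2 ⟨hu, rfl⟩) (Within.of_reachable (fun x y h => h.2) hr) (by simpa using hR)

theorem ensures_compStep [Fintype V] {i : ℕ} {c : V → CompState} (hε : 0 ≤ ε)
    (hR : ((Fintype.card V * δ : ℕ) : ℝ) ≤ R) (h : CompInv N δ i c) :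
    (compStep hB ε R δ i).Ensures N c (CompInv N δ (i + 1)) := by
  intro F root d hF hroot
  rw [h.keptGraph_eq] at hF
  have hmem := mem_forest_iff (S := fun v => (c v).cand = true ∧ (N.id v).testBit i = false) hε hR
    (fun v x => by rw [map_val_eq_some_iff]; simp [h.id]) hF
  set H := lightGraph N.graph N.len δ
  refine ⟨h.id, h.nlen, fun v => ?_, fun u v hu hv hr j hj => ?_⟩
  · by_cases hv : F v ≠ none
    · obtain ⟨u, ⟨hu, hb⟩, hr⟩ := (hmem v).1 hv
      exact ⟨u, by simp [hu, hb, h.id], hr⟩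
    · obtain ⟨u, hu, hr⟩ := h.exists_cand v
      have hFu : F u = none := by
        by_contra hFu
        obtain ⟨w, hw, hwr⟩ := (hmem u).1 hFu
        exact hv ((hmem v).2 ⟨w, hw, hwr.trans hr⟩)
      exact ⟨u, by simp [hu, hFu], hr⟩
  · simp only [Bool.and_eq_true, Bool.or_eq_true, Option.isNone_map, Bool.not_eq_true', h.id] at hu hv
    rcases Nat.lt_succ_iff_lt_or_eq.1 hj with hj | rfl
    · exact h.bits u v hu.1 hv.1 hr j hj
    -- A surviving candidate with bit `j` clear makes the forest cover its component, and then
    -- candidates with the bit set withdraw.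
    · have key : ∀ u v, ((c u).cand = true ∧ ((F u).isNone = true ∨ (N.id u).testBit j = false)) →
          ((c v).cand = true ∧ ((F v).isNone = true ∨ (N.id v).testBit j = false)) →
          H.Reachable u v → (N.id u).testBit j = false → (N.id v).testBit j = false := by
        intro u v hu hv hr hb
        refine hv.2.resolve_left fun hFv => ?_
        exact (hmem v).2 ⟨u, ⟨hu.1, hb⟩, hr⟩ (by simpa using hFv)
      have h1 := key u v hu hv hr
      have h2 := key v u hv hu hr.symm
      revert h1 h2
      cases (N.id u).testBit j <;> cases (N.id v).testBit j <;> simp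

theorem lightGraph_keepsBall (v : V) :
    KeepsBall N.graph (lightGraph N.graph N.len δ) N.len δ v :=
  fun _ _ _ h _ hle => ⟨h, by omega⟩

/-- No edge of length at most `⌊D⌋₊` is cut, so a single partition preserves all balls. Surviving
candidates of a component agree on all bits, hence coincide. -/
theorem compAlgorithm_solves [Fintype V] {b : ℕ} {D Δ : ℝ} (hD : 0 ≤ D) (hε : 0 ≤ ε)
    (hid : ∀ v, N.id v < 2 ^ b) (hR : ((Fintype.card V * ⌊D⌋₊ : ℕ) : ℝ) ≤ R)
    (hΔ : ((2 * (Fintype.card V * ⌊D⌋₊) : ℕ) : ℝ) ≤ Δ) :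
    (compAlgorithm hB ε R ⌊D⌋₊ b).Solves N fun label => IsSparseCover N.graph N.len D Δ label := by
  rw [Algorithm.Solves, compAlgorithm, ensures_append]
  refine (ensures_loop (N := N) (body := fun i => [compStep hB ε R ⌊D⌋₊ i]) (CompInv N ⌊D⌋₊)
    (fun i _ c hc => ensures_compStep hε hR hc)
    ⟨fun _ => rfl, fun _ => rfl, fun v => ⟨v, rfl, .refl _⟩, by simp⟩).mono fun c h => ?_
  intro F root d hF hroot
  rw [h.keptGraph_eq] at hF
  have hsrc : ∀ v x, ((if (c v).cand then some (⟨0, hB⟩ : Fin B) else none).map Fin.val) = some x ↔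
      (c v).cand = true ∧ x = 0 := fun v x => map_val_eq_some_iff hB
  have hmem : ∀ v, F v ≠ none := fun v => (mem_forest_iff hε hR hsrc hF v).2 (h.exists_cand v)
  have hcand : ∀ v, (c (root v)).cand = true := fun v => by
    obtain ⟨x, hx, -⟩ := hF.exists_src hε (hroot v (hmem v))
    exact ((hsrc _ _).1 hx).1
  have hreach : ∀ v, (lightGraph N.graph N.len ⌊D⌋₊).Reachable (root v) v := fun v =>
    ((hroot v (hmem v)).within hF.forest.adj).reachable
  have hlabel : ∀ v, (((F v).map fun p => ForestReply.mk (p.map N.id) (N.id (root v)) (d v)).map ForestReply.root).getD 0 = N.id (root v) := by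
    intro v
    obtain ⟨p, hp⟩ := Option.ne_none_iff_exists'.1 (hmem v)
    simp [hp]
  simp only [Ensures, hlabel]
  have hadj : ∀ x y, (lightGraph N.graph N.len ⌊D⌋₊).Adj x y → N.id (root x) = N.id (root y) := by
    intro x y hxy
    refine Nat.eq_of_testBit_eq fun j => ?_
    rcases lt_or_ge j b with hj | hj
    · exact h.bits _ _ (hcand x) (hcand y)
        (((hreach x).trans hxy.reachable).trans (hreach y).symm) j hj
    · rw [Nat.testBit_lt_two_pow ((hid _).trans_le (Nat.pow_le_pow_right (by simp) hj)),
        Nat.testBit_lt_two_pow ((hid _).trans_le (Nat.pow_le_pow_right (by simp) hj))]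
  refine ⟨fun i C hC => ?_, fun v => ?_⟩
  · refine (strongDiam_cluster_le N.id_injective (H := lightGraph N.graph N.len ⌊D⌋₊)
      (fun _ _ h => h.1) hadj
      (fun v => ⟨root v, rfl, Within.of_reachable (fun x y h => h.2) (hreach v)⟩) hC).trans ?_
    rw [← ENNReal.ofReal_natCast]
    exact ENNReal.ofReal_le_ofReal hΔ
  · have : {i : Fin 1 | ∃ C ∈ clusters (fun u => N.id (root u)), ball N.graph N.len v D ⊆ C} =
        Set.univ := Set.eq_univ_of_forall fun _ =>
      ⟨_, cluster_mem _ v, (lightGraph_keepsBall v).ball_subset hD hadj⟩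
    rw [this]
    simp

end Components

/-! ### The sparse cover algorithm -/

/-- Parameters of the algorithm: words are below `B`, identifiers have `b` bits, there are `T`
rounds, balls have radius `d`, and in phase `i` of a round the delays are multiples of `gap i` and
distances to terminals at most `radius i`. -/
structure CoverParams where
  B : ℕ
  B_pos : 0 < B
  b : ℕ
  T : ℕ
  d : ℕ
  ε : ℝ
  gap : ℕ → ℕ
  radius : ℕ → ℕ

/-- What a node remembers of its round: `keep` is the current graph, `term` tells whether the node is
a terminal, `root` is the label of its cluster, and `bad` tells whether its ball may have been cut. -/
structure NodeCore where
  id : ℕ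
  nlen : ℕ → Option ℕ
  keep : ℕ → Bool
  term : Bool
  root : ℕ
  bad : Bool
  weight : ℕ
  total : ℕ
  label : ℕ → ℕ

/-- What a node computes for one delay. -/
structure NodeScratch where
  root : ℕ
  isRoot : Bool
  diff : ℕ → Bool
  near : Bool

structure NodeState where
  core : NodeCore
  done : Bool
  scr : NodeScratch

def NodeCore.commit (s : NodeCore) (x : NodeScratch) : NodeCore :=
  { s with
    keep := fun j => s.keep j && !x.diff j
    term := x.isRoot
    root := x.root
    bad := s.bad || x.near }

def NodeCore.startRound (s : NodeCore) (tot : ℕ) : NodeCore :=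
  { s with keep := fun _ => true, term := true, root := s.id, bad := false, total := tot }

def NodeCore.endRound (s : NodeCore) (k : ℕ) : NodeCore :=
  { s with
    label := Function.update s.label k s.root
    weight := if s.bad then 2 * s.weight else s.weight }

/-- The node is at a short edge whose other endpoint has the other colour. -/
def NodeState.AtBoundary (s : NodeState) (d : ℕ) : Prop :=
  ∃ j l, s.core.nlen j = some l ∧ l ≤ d ∧ s.scr.diff j = true

/-- The word that a node sends over an edge of the current graph to tell its colour. -/
def colorCode (c : Bool) : ℕ := 1 + c.toNat

namespace CoverParams

variable (P : CoverParams)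

/-- The number of delays that are tried in a phase. -/
def tries : ℕ := 10 * P.b

def word (x : ℕ) : Fin P.B := ⟨x % P.B, Nat.mod_lt _ P.B_pos⟩

theorem word_val {x : ℕ} (h : x < P.B) : (P.word x).val = x := Nat.mod_eq_of_lt h

def growStep (i j : ℕ) : Instr NodeState P.B :=
  .dist P.ε (P.radius (i + 1)) (fun s => s.core.keep)
    (fun s => if s.core.term then
      some (P.word (if s.core.id.testBit i then j * P.gap i else 0)) else none)
    fun s r => { s with scr := { s.scr with
      root := (r.map ForestReply.root).getD 0
      isRoot := r.any fun x => x.parent.isNone } }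

/-- The word 0 signals an edge that the sender has dropped, so a difference is recorded only if both
endpoints keep the edge. -/
def colorStep (i : ℕ) : Instr NodeState P.B :=
  .exchange
    (fun s j => P.word (if s.core.keep j then colorCode (s.scr.root.testBit i) else 0))
    fun s f => { s with scr := { s.scr with
      diff := fun j => s.core.keep j &&
        (f j).any fun x => x.val ≠ 0 ∧ x.val ≠ colorCode (s.scr.root.testBit i) } }

-- The threshold is twice the radius because the oracle is only approximate: nothing within `d` of
-- the boundary is missed, and everything flagged is within `2 * d` of it.
open Classical in
def nearStep : Instr NodeState P.B :=
  .dist P.ε P.d (fun s => s.core.keep)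
    (fun s => if s.AtBoundary P.d then some ⟨0, P.B_pos⟩ else none)
    fun s r => { s with scr := { s.scr with near := r.any fun x => x.dist ≤ 2 * P.d } }

/-- All nodes receive the same sum and store the same total, so they decide alike. The schedule is
fixed; after a success the remaining tries have no effect. -/
def commitStep : Instr NodeState P.B :=
  .globalAgg (fun s => P.word (if s.scr.near then s.core.weight else 0))
    fun s tot => if s.done = false ∧ P.tries * tot ≤ s.core.total then
      { s with core := s.core.commit s.scr, done := true } else s

/-- One try: the vertices are split by bit `i` of their approximately nearest terminals, with delay
`j * gap i` for the terminals with the bit. If few balls are cut, then this split is adopted. -/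
def attempt (i j : ℕ) : List (Instr NodeState P.B) :=
  [P.growStep i j, P.colorStep i, P.nearStep, P.commitStep]

def resetStep : Instr NodeState P.B := .globalAgg (fun _ => P.word 0) fun s _ => { s with done := false }

def phase (i : ℕ) : List (Instr NodeState P.B) := loop P.tries (P.attempt i) ++ [P.resetStep]

def startStep : Instr NodeState P.B :=
  .globalAgg (fun s => P.word s.core.weight) fun s tot => { s with core := s.core.startRound tot }

def endStep (k : ℕ) : Instr NodeState P.B :=
  .globalAgg (fun _ => P.word 0) fun s _ => { s with core := s.core.endRound k }

/-- One round computes one partition; weights of vertices whose balls were cut are doubled. -/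
def round (k : ℕ) : List (Instr NodeState P.B) :=
  P.startStep :: (loop P.b P.phase ++ [P.endStep k])

def algorithm : Algorithm P.B where
  State := NodeState
  init id nlen := ⟨⟨id, nlen, fun _ => true, true, id, false, 1, 0, fun _ => 0⟩, false,
    ⟨0, false, fun _ => false, false⟩⟩
  steps := loop P.T P.round
  t := P.T
  output s i := s.core.label i

/-- The inequalities between the parameters that make the algorithm work. -/
structure Valid : Prop where
  three_le : 3 ≤ P.B
  b_pos : 0 < P.b
  ε_nonneg : 0 ≤ P.ε
  ε_le : P.ε ≤ 1
  radius_succ : ∀ i < P.b,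
    (1 + P.ε) * ((P.radius i + P.tries * P.gap i : ℕ) : ℝ) ≤ P.radius (i + 1)
  window : ∀ i < P.b,
    6 * P.ε * ((P.radius i + P.tries * P.gap i : ℕ) : ℝ) + 36 * P.d < P.gap i
  delay_lt : ∀ i < P.b, P.tries * P.gap i < P.B
  weight_le : 2 ^ P.T ≤ P.B

end CoverParams

/-! ### Correctness of a phase -/

section Phase

variable {P : CoverParams} {V : Type*} {N : Network V}

/-- The graph of the edges that are not cut yet. -/
def coreGraph (N : Network V) (core : V → NodeCore) : SimpleGraph V :=
  keptGraph N fun v => (core v).keep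

theorem coreGraph_le (core : V → NodeCore) : coreGraph N core ≤ N.graph := fun _ _ h => h.1

def isTerm (core : V → NodeCore) (v : V) : Prop := (core v).term = true

/-- The situation before phase `i` of a round in which the vertices have weights `w`. -/
structure PhaseInv [Fintype V] (P : CoverParams) (N : Network V) (w : V → ℕ) (lab : V → ℕ → ℕ)
    (i : ℕ) (core : V → NodeCore) : Prop where
  id : ∀ v, (core v).id = N.id v
  nlen : ∀ v, (core v).nlen = N.nbrLen v
  weight : ∀ v, (core v).weight = w v
  label : ∀ v, (core v).label = lab v
  total : ∀ v, (core v).total = ∑ u, w u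
  ruling : IsRuling (coreGraph N core) N.len N.id (isTerm core) i (P.radius i)
    fun v => (core v).root
  ball : ∀ v, (core v).bad = false → KeepsBall N.graph (coreGraph N core) N.len P.d v
  bad_le : P.tries * ∑ v, (if (core v).bad then w v else 0) ≤ i * ∑ v, w v

/-- Vertices at a short edge of `H` that is cut. -/
def BoundaryOf (H : SimpleGraph V) (len : Sym2 V → ℕ) (d : ℕ) (col : V → Bool) (x : V) : Prop :=
  ∃ y, H.Adj x y ∧ col x ≠ col y ∧ len s(x, y) ≤ d

/-- The results of a try with delay `s`. -/
def AttemptSpec (P : CoverParams) (N : Network V) (i s : ℕ) (core : V → NodeCore)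
    (scr : V → NodeScratch) : Prop :=
  ∃ (F : ParentMap V) (root : V → V) (dF : V → ℕ),
    IsDistAnswer (coreGraph N core) N.len (splitSrc N.id (isTerm core) i s) P.ε (P.radius (i + 1)) F ∧
    (∀ v, F v ≠ none → RootPath N.len F v (root v) (dF v)) ∧
    (∀ v, (scr v).root = N.id (root v)) ∧
    (∀ v, (scr v).isRoot = true ↔ F v = some none) ∧
    (∀ v u, N.graph.Adj v u → ((scr v).diff (N.id u) = true ↔
      (coreGraph N core).Adj v u ∧ side N.id i root v ≠ side N.id i root u)) ∧
    ∀ v, ((scr v).near = true → ∃ x,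
        BoundaryOf (coreGraph N core) N.len P.d (side N.id i root) x ∧
        Within (coreGraph N core) N.len (2 * P.d) x v) ∧
      ((scr v).near = false → ∀ x,
        BoundaryOf (coreGraph N core) N.len P.d (side N.id i root) x →
        ¬ Within (coreGraph N core) N.len P.d x v)

theorem CoverParams.Valid.radius_add_le (hP : P.Valid) {i s : ℕ} (hi : i < P.b)
    (hs : s ≤ P.tries * P.gap i) :
    (1 + P.ε) * ((P.radius i + s : ℕ) : ℝ) ≤ P.radius (i + 1) ∧
      ((P.radius i + s : ℕ) : ℝ) ≤ P.radius (i + 1) := by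
  have h : (1 + P.ε) * ((P.radius i + s : ℕ) : ℝ) ≤ P.radius (i + 1) := by
    refine le_trans ?_ (hP.radius_succ i hi)
    have := hP.ε_nonneg
    gcongr
  exact ⟨h, le_trans (le_mul_of_one_le_left (by positivity) (by linarith [hP.ε_nonneg])) h⟩

/-- Flagged vertices are charged to a condition on the delay alone, which makes different tries
comparable whatever the oracle answered. -/
theorem AttemptSpec.conflict [Fintype V] {w : V → ℕ} {lab : V → ℕ → ℕ} {i s : ℕ}
    {core : V → NodeCore} {scr : V → NodeScratch} (hP : P.Valid) (hi : i < P.b)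
    (hs : s ≤ P.tries * P.gap i) (hcore : PhaseInv P N w lab i core)
    (h : AttemptSpec P N i s core scr) {v : V} (hv : (scr v).near = true) :
    Conflict (coreGraph N core) N.len N.id (isTerm core) i (P.radius i) P.d P.ε s v := by
  obtain ⟨F, root, dF, hF, hroot, -, -, -, hnear⟩ := h
  obtain ⟨x, ⟨y, hxy, hne, hd⟩, hw⟩ := (hnear v).1 hv
  exact conflict_of_within hcore.ruling hP.ε_nonneg hF hroot (hP.radius_add_le hi hs).2 hxy hne hd hw

theorem AttemptSpec.commit [Fintype V] {w : V → ℕ} {lab : V → ℕ → ℕ} {i s : ℕ}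
    {core : V → NodeCore} {scr : V → NodeScratch} (hP : P.Valid) (hi : i < P.b)
    (hs : s ≤ P.tries * P.gap i) (hcore : PhaseInv P N w lab i core)
    (h : AttemptSpec P N i s core scr)
    (hle : P.tries * ∑ v, (if (scr v).near then w v else 0) ≤ ∑ v, w v) :
    PhaseInv P N w lab (i + 1) fun v => (core v).commit (scr v) := by
  obtain ⟨F, root, dF, hF, hroot, hrt, hisRoot, hdiff, hnear⟩ := h
  have hgraph : coreGraph N (fun v => (core v).commit (scr v)) =
      cutGraph (coreGraph N core) (side N.id i root) := by
    ext u v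
    change (N.graph.Adj u v ∧ ((core u).keep (N.id v) && !(scr u).diff (N.id v)) = true ∧
      ((core v).keep (N.id u) && !(scr v).diff (N.id u)) = true) ↔
      (N.graph.Adj u v ∧ (core u).keep (N.id v) = true ∧ (core v).keep (N.id u) = true) ∧
      side N.id i root u = side N.id i root v
    by_cases ha : N.graph.Adj u v
    · have h1 := hdiff u v ha
      have h2 := hdiff v u ha.symm
      change _ ↔ (N.graph.Adj u v ∧ (core u).keep (N.id v) = true ∧
        (core v).keep (N.id u) = true) ∧ _ at h1
      change _ ↔ (N.graph.Adj v u ∧ (core v).keep (N.id u) = true ∧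
        (core u).keep (N.id v) = true) ∧ _ at h2
      simp only [Bool.and_eq_true, Bool.not_eq_true', ← Bool.not_eq_true, h1, h2, ha, ha.symm]
      tauto
    · simp [ha]
  refine ⟨hcore.id, hcore.nlen, hcore.weight, hcore.label, hcore.total, ?_, fun v hv => ?_, ?_⟩
  · rw [hgraph]
    have := hcore.ruling.split hP.ε_nonneg hF hroot (hP.radius_add_le hi hs).2
      (hP.radius_add_le hi hs).1
    have h1 : isTerm (fun v => (core v).commit (scr v)) = fun v => F v = some none :=
      funext fun v => propext (hisRoot v)
    have h2 : (fun v => ((core v).commit (scr v)).root) = fun v => N.id (root v) := funext hrt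
    rw [h1, h2]
    exact this
  · rw [hgraph]
    simp only [NodeCore.commit, Bool.or_eq_false_iff] at hv
    exact (hcore.ball v hv.1).cut fun x y hxy hne hd => (hnear v).2 hv.2 x ⟨y, hxy, hne, hd⟩
  · have : ∑ v, (if ((core v).commit (scr v)).bad then w v else 0) ≤
        ∑ v, (if (core v).bad then w v else 0) + ∑ v, (if (scr v).near then w v else 0) := by
      rw [← Finset.sum_add_distrib]
      refine Finset.sum_le_sum fun v _ => ?_
      simp only [NodeCore.commit]
      by_cases h1 : (core v).bad = true <;> by_cases h2 : (scr v).near = true <;> simp [h1, h2]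
    calc _ ≤ _ := Nat.mul_le_mul_left _ this
      _ ≤ _ := by
        rw [mul_add, add_mul, one_mul]
        exact add_le_add hcore.bad_le hle

/-- The situation after `j` tries of phase `i`: either there was a split that cuts few balls, or
disjoint sets of large weight are in conflict for the delays tried so far. -/
def AttemptInv [Fintype V] (P : CoverParams) (N : Network V) (w : V → ℕ) (lab : V → ℕ → ℕ) (i : ℕ)
    (core : V → NodeCore) (j : ℕ) (c : V → NodeState) : Prop :=
  ((∀ v, (c v).done = false ∧ (c v).core = core v) ∧ ∃ S : ℕ → Finset V, ∀ j' < j,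
    (∀ v ∈ S j', Conflict (coreGraph N core) N.len N.id (isTerm core) i (P.radius i) P.d P.ε
      (j' * P.gap i) v) ∧ ∑ v, w v < P.tries * ∑ v ∈ S j', w v) ∨
  (∀ v, (c v).done = true) ∧ PhaseInv P N w lab (i + 1) fun v => (c v).core

/-- If every try failed, there would be `tries` conflict sets, pairwise disjoint by the separation
of the delays, each of weight above a `1/tries` fraction of the total. -/
theorem AttemptInv.done [Fintype V] {w : V → ℕ} {lab : V → ℕ → ℕ} {i : ℕ} {core : V → NodeCore}
    {c : V → NodeState} (hP : P.Valid) (hi : i < P.b)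
    (h : AttemptInv P N w lab i core P.tries c) :
    PhaseInv P N w lab (i + 1) fun v => (c v).core := by
  classical
  refine (h.resolve_left ?_).2
  rintro ⟨-, S, hS⟩
  have key : ∀ j j', j < j' → j' < P.tries → Disjoint (S j) (S j') := by
    intro j j' hjj hj'
    rw [Finset.disjoint_left]
    intro v hv hv'
    refine ((hS j (hjj.trans hj')).1 v hv).false_of_lt hP.ε_nonneg hP.ε_le ((hS j' hj').1 v hv') ?_
    have h1 : ((j * P.gap i : ℕ) : ℝ) + P.gap i ≤ (j' * P.gap i : ℕ) := by
      have : j * P.gap i + P.gap i ≤ j' * P.gap i := by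
        rw [← Nat.succ_mul]
        exact Nat.mul_le_mul_right _ hjj
      exact_mod_cast this
    have h2 : 6 * P.ε * ((P.radius i : ℝ) + (j' * P.gap i : ℕ)) ≤
        6 * P.ε * ((P.radius i + P.tries * P.gap i : ℕ) : ℝ) := by
      have := hP.ε_nonneg
      push_cast
      gcongr
    linarith [hP.window i hi]
  have hdisj : Set.PairwiseDisjoint (Finset.range P.tries : Set ℕ) S := by
    intro j hj j' hj' hne
    simp only [Finset.coe_range, Set.mem_Iio] at hj hj'
    rcases lt_or_gt_of_ne hne with h | h
    · exact key j j' h hj'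
    · exact (key j' j h hj).symm
  have h1 : ∑ j ∈ Finset.range P.tries, ∑ v ∈ S j, w v ≤ ∑ v, w v := by
    rw [← Finset.sum_biUnion hdisj]
    exact Finset.sum_le_sum_of_subset (Finset.subset_univ _)
  have hpos : 0 < P.tries := Nat.mul_pos (by norm_num) hP.b_pos
  have h2 : P.tries * ∑ v, w v < ∑ j ∈ Finset.range P.tries, P.tries * ∑ v ∈ S j, w v := by
    have := Finset.sum_lt_sum_of_nonempty (s := Finset.range P.tries) (by simpa using hpos.ne')
      (fun j hj => (hS j (Finset.mem_range.1 hj)).2)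
    simpa using this
  rw [← Finset.mul_sum] at h2
  exact absurd h1 (not_le.2 (lt_of_mul_lt_mul_left h2 (Nat.zero_le _)))

end Phase

/-! ### Execution of tries and phases -/

section Attempt

variable {P : CoverParams} {V : Type*} [Fintype V] {N : Network V}

theorem colorCode_ne_zero (c : Bool) : colorCode c ≠ 0 := by simp [colorCode]

theorem colorCode_inj {c c' : Bool} : colorCode c = colorCode c' ↔ c = c' := by
  cases c <;> cases c' <;> simp [colorCode]

theorem colorCode_lt (hP : P.Valid) (c : Bool) : colorCode c < P.B := by
  have := hP.three_le
  cases c <;> simp [colorCode] <;> omega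

theorem ensures_attempt_of_done {w : V → ℕ} {lab : V → ℕ → ℕ} {i j : ℕ} {c : V → NodeState}
    (hd : ∀ v, (c v).done = true) (h : PhaseInv P N w lab (i + 1) fun v => (c v).core) :
    Ensures N (fun c => (∀ v, (c v).done = true) ∧
      PhaseInv P N w lab (i + 1) fun v => (c v).core) (P.attempt i j) c := by
  intro F root dF _ _ F₂ root₂ d₂ _ _
  dsimp only [Ensures, Instr.Ensures, CoverParams.colorStep, CoverParams.nearStep,
    CoverParams.commitStep]
  simp only [hd, Bool.true_eq_false, false_and, if_false]
  exact ⟨fun _ => trivial, h⟩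

theorem ensures_attempt_of_not_done {w : V → ℕ} {lab : V → ℕ → ℕ} {i j : ℕ} {core : V → NodeCore}
    {c : V → NodeState} (hP : P.Valid) (hi : i < P.b) (hj : j < P.tries) (hw : ∀ v, w v < P.B)
    (hcore : PhaseInv P N w lab i core) (hc : ∀ v, (c v).done = false ∧ (c v).core = core v) :
    Ensures N (fun c' => ∃ scr : V → NodeScratch, AttemptSpec P N i (j * P.gap i) core scr ∧
      ∀ v, c' v = if P.tries * ∑ u, (if (scr u).near then w u else 0) ≤ ∑ u, w u then
        ⟨(core v).commit (scr v), true, scr v⟩ else ⟨core v, false, scr v⟩) (P.attempt i j) c := by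
  classical
  obtain ⟨scr₀, rfl⟩ : ∃ scr₀ : V → NodeScratch, c = fun v => ⟨core v, false, scr₀ v⟩ :=
    ⟨fun v => (c v).scr, funext fun v => by rw [← (hc v).1, ← (hc v).2]⟩
  clear hc
  have hs : j * P.gap i ≤ P.tries * P.gap i := Nat.mul_le_mul_right _ hj.le
  intro F root dF hF hroot
  dsimp only at hF
  have hsrc : (fun v => Option.map Fin.val (if (core v).term = true then
      some (P.word (if (core v).id.testBit i = true then j * P.gap i else 0)) else none)) =
      splitSrc N.id (isTerm core) i (j * P.gap i) := by
    funext v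
    rw [splitSrc, hcore.id]
    have h0 : (if (N.id v).testBit i = true then j * P.gap i else 0) < P.B := by
      have := hP.delay_lt i hi
      split_ifs <;> omega
    by_cases ht : (core v).term = true
    · rw [if_pos ht, if_pos (show isTerm core v from ht), Option.map_some, P.word_val h0]
    · rw [if_neg ht, if_neg (show ¬ isTerm core v from ht), Option.map_none]
  rw [hsrc] at hF
  -- The forest spans all vertices, so the default root 0 never enters.
  have hmem := hcore.ruling.mem_forest hF (hP.radius_add_le hi hs).2
  suffices key : ∀ (isRoot : V → Bool) (c₁ : V → NodeState),
      (∀ v, isRoot v = true ↔ F v = some none) →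
      (∀ v, c₁ v = ⟨core v, false, ⟨N.id (root v), isRoot v, (scr₀ v).diff, (scr₀ v).near⟩⟩) →
      Ensures N (fun c' => ∃ scr : V → NodeScratch, AttemptSpec P N i (j * P.gap i) core scr ∧
        ∀ v, c' v = if P.tries * ∑ u, (if (scr u).near then w u else 0) ≤ ∑ u, w u then
          ⟨(core v).commit (scr v), true, scr v⟩ else ⟨core v, false, scr v⟩)
        [P.colorStep i, P.nearStep, P.commitStep] c₁ by
    refine key (fun v => ((F v).map fun p =>
      ForestReply.mk (p.map N.id) (N.id (root v)) (dF v)).any fun x => x.parent.isNone) _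
      (fun v => ?_) (fun v => ?_)
    · obtain ⟨p, hp⟩ := Option.ne_none_iff_exists'.1 (hmem v)
      cases p <;> simp [hp]
    · obtain ⟨p, hp⟩ := Option.ne_none_iff_exists'.1 (hmem v)
      simp [hp]
  intro isRoot c₁ hisRoot hc₁
  obtain rfl := funext hc₁
  set diff : V → ℕ → Bool := fun v k => (core v).keep k && (Option.map (fun u =>
    P.word (if (core u).keep (N.id v) = true then colorCode ((N.id (root u)).testBit i) else 0))
    (N.nbr v k)).any fun x => decide (x.val ≠ 0 ∧ x.val ≠ colorCode ((N.id (root v)).testBit i))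
    with hdiff_def
  have hdiff : ∀ v u, N.graph.Adj v u → (diff v (N.id u) = true ↔
      (coreGraph N core).Adj v u ∧ side N.id i root v ≠ side N.id i root u) := by
    intro v u ha
    change _ ↔ (N.graph.Adj v u ∧ (core v).keep (N.id u) = true ∧ (core u).keep (N.id v) = true) ∧ _
    simp only [hdiff_def, N.nbr_id ha, Option.map_some, Option.any_some, Bool.and_eq_true,
      decide_eq_true_eq, ha, true_and]
    by_cases hk : (core u).keep (N.id v) = true
    · rw [if_pos hk, P.word_val (colorCode_lt hP _)]
      simp only [hk, ne_eq, colorCode_ne_zero, colorCode_inj, not_false_eq_true, true_and, and_true,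
        side]
      rw [eq_comm (a := (N.id (root v)).testBit i)]
    · rw [if_neg hk, P.word_val P.B_pos]
      simp [hk]
  change Ensures N _ [P.nearStep, P.commitStep]
    fun v => NodeState.mk (core v) false ⟨N.id (root v), isRoot v, diff v, (scr₀ v).near⟩
  clear_value diff
  intro F₂ root₂ d₂ hF₂ hroot₂
  have hnear := hF₂.near (S := BoundaryOf (coreGraph N core) N.len P.d (side N.id i root))
    (fun v x => by
      rw [map_val_eq_some_iff]
      refine and_congr_left fun _ => ?_
      simp only [NodeState.AtBoundary, hcore.nlen]
      constructor
      · rintro ⟨k, l, hl, hld, hk⟩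
        obtain ⟨u, hu, rfl⟩ := Option.map_eq_some_iff.1 hl
        obtain ⟨ha, rfl⟩ := (N.nbr_eq_some_iff v u k).1 hu
        have := (hdiff v u ha).1 hk
        exact ⟨u, this.1, this.2, hld⟩
      · rintro ⟨u, hu, hne, hl⟩
        have ha : N.graph.Adj v u := hu.1
        exact ⟨N.id u, _, N.nbrLen_id ha, hl, (hdiff v u ha).2 ⟨hu, hne⟩⟩)
    hP.ε_nonneg hP.ε_le hroot₂
  set near : V → Bool := fun v => ((F₂ v).map fun p =>
    ForestReply.mk (p.map N.id) (N.id (root₂ v)) (d₂ v)).any fun x => decide (x.dist ≤ 2 * P.d)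
    with hnear_def
  have hnear_iff : ∀ v, near v = true ↔ F₂ v ≠ none ∧ d₂ v ≤ 2 * P.d := by
    intro v
    cases h : F₂ v <;> simp [hnear_def, h]
  change Ensures N _ [P.commitStep]
    fun v => NodeState.mk (core v) false ⟨N.id (root v), isRoot v, diff v, near v⟩
  clear_value near
  refine ⟨fun v => ⟨N.id (root v), isRoot v, diff v, near v⟩, ⟨F, root, dF, hF, hroot, fun _ => rfl,
    hisRoot, hdiff, fun v => ⟨fun h => (hnear v).1 ((hnear_iff v).1 h), fun h => (hnear v).2 ?_⟩⟩,
    fun v => ?_⟩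
  · rw [← hnear_iff]
    simpa using h
  · have hval : ∀ u, (P.word (if near u = true then (core u).weight else 0)).val =
        if near u = true then w u else 0 := by
      intro u
      rw [hcore.weight]
      refine P.word_val ?_
      split_ifs
      · exact hw u
      · exact P.B_pos
    simp only [hval, hcore.total, true_and]

theorem ensures_attempt {w : V → ℕ} {lab : V → ℕ → ℕ} {i j : ℕ} {core : V → NodeCore}
    {c : V → NodeState} (hP : P.Valid) (hi : i < P.b) (hj : j < P.tries) (hw : ∀ v, w v < P.B)
    (hcore : PhaseInv P N w lab i core) (h : AttemptInv P N w lab i core j c) :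
    Ensures N (AttemptInv P N w lab i core (j + 1)) (P.attempt i j) c := by
  classical
  rcases h with ⟨hc, S, hS⟩ | ⟨hd, hinv⟩
  · refine (ensures_attempt_of_not_done hP hi hj hw hcore hc).mono ?_
    rintro c' ⟨scr, hscr, hc'⟩
    have hs : j * P.gap i ≤ P.tries * P.gap i := Nat.mul_le_mul_right _ hj.le
    by_cases hle : P.tries * ∑ u, (if (scr u).near then w u else 0) ≤ ∑ u, w u
    · simp only [if_pos hle] at hc'
      refine .inr ⟨fun v => by rw [hc'], ?_⟩
      simpa only [hc'] using hscr.commit hP hi hs hcore hle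
    · simp only [if_neg hle] at hc'
      refine .inl ⟨fun v => by simp [hc'],
        Function.update S j (Finset.univ.filter fun v => (scr v).near = true), fun j' hj' => ?_⟩
      rcases Nat.lt_succ_iff_lt_or_eq.1 hj' with hlt | rfl
      · rw [Function.update_of_ne hlt.ne]
        exact hS j' hlt
      · rw [Function.update_self]
        refine ⟨fun v hv => hscr.conflict hP hi hs hcore (Finset.mem_filter.1 hv).2, ?_⟩
        rw [Finset.sum_filter]
        exact not_le.1 hle
  · exact (ensures_attempt_of_done hd hinv).mono fun _ h => .inr h

theorem ensures_phase {w : V → ℕ} {lab : V → ℕ → ℕ} {i : ℕ} {c : V → NodeState} (hP : P.Valid)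
    (hi : i < P.b) (hw : ∀ v, w v < P.B)
    (h : (∀ v, (c v).done = false) ∧ PhaseInv P N w lab i fun v => (c v).core) :
    Ensures N (fun c => (∀ v, (c v).done = false) ∧ PhaseInv P N w lab (i + 1) fun v => (c v).core)
      (P.phase i) c := by
  rw [CoverParams.phase, ensures_append]
  refine (ensures_loop (AttemptInv P N w lab i fun v => (c v).core)
    (fun j hj c' hc' => ensures_attempt hP hi hj hw h.2 hc')
    (.inl ⟨fun v => ⟨h.1 v, rfl⟩, fun _ => ∅, by simp⟩)).mono fun c' hc' => ?_
  exact ⟨fun _ => rfl, AttemptInv.done (c := c') hP hi hc'⟩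

end Attempt

/-! ### Rounds and multiplicative weights -/

section Rounds

variable {P : CoverParams} {V : Type*} [Fintype V] {N : Network V} {D : ℝ}

/-- The ball of `v` is inside a cluster of the `i`-th partition. -/
def Padded (N : Network V) (D : ℝ) (lab : V → ℕ → ℕ) (i : ℕ) (v : V) : Prop :=
  ∃ C ∈ clusters (fun u => lab u i), ball N.graph N.len v D ⊆ C

open Classical in
/-- The situation after `k` rounds; `β v` is the number of times that the ball of `v` may have been
cut. -/
structure RoundInv (P : CoverParams) (N : Network V) (D : ℝ) (k : ℕ) (c : V → NodeState) : Prop where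
  id : ∀ v, (c v).core.id = N.id v
  nlen : ∀ v, (c v).core.nlen = N.nbrLen v
  done : ∀ v, (c v).done = false
  exists_count : ∃ β : V → ℕ, (∀ v, (c v).core.weight = 2 ^ β v) ∧
    (∀ v, β v ≤ k) ∧
    (∀ v, k ≤ β v + ((Finset.range k).filter fun i =>
      Padded N D (fun u => (c u).core.label) i v).card) ∧
    10 ^ k * ∑ v, 2 ^ β v ≤ 11 ^ k * Fintype.card V
  diam : ∀ i < k, ∀ C ∈ clusters (fun u => (c u).core.label i),
    strongDiam N.graph N.len C ≤ ((2 * P.radius P.b : ℕ) : ℝ≥0∞)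

theorem phaseInv_start {w : V → ℕ} {lab : V → ℕ → ℕ} {core : V → NodeCore}
    (hid : ∀ v, (core v).id = N.id v) (hnlen : ∀ v, (core v).nlen = N.nbrLen v)
    (hw : ∀ v, (core v).weight = w v) (hlab : ∀ v, (core v).label = lab v) :
    PhaseInv P N w lab 0 fun v => (core v).startRound (∑ u, w u) := by
  refine ⟨hid, hnlen, hw, hlab, fun _ => rfl, ⟨fun v => ⟨v, (hid v).symm, rfl, .refl _ _⟩, ?_⟩,
    fun v _ x y k h _ _ => ⟨h, rfl, rfl⟩, ?_⟩
  · simp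
  · simp [NodeCore.startRound]

/-- In the final graph of a round, the clusters are unions of components. -/
theorem PhaseInv.root_eq {w : V → ℕ} {lab : V → ℕ → ℕ} {core : V → NodeCore}
    (hid : ∀ v, N.id v < 2 ^ P.b) (h : PhaseInv P N w lab P.b core) {x y : V}
    (hxy : (coreGraph N core).Adj x y) : (core x).root = (core y).root := by
  obtain ⟨r, hr, hrt, hrw⟩ := h.ruling.root x
  obtain ⟨r', hr', hrt', hrw'⟩ := h.ruling.root y
  rw [← hr, ← hr']
  refine Nat.eq_of_testBit_eq fun j => ?_
  rcases lt_or_ge j P.b with hj | hj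
  · exact h.ruling.bits r r' hrt hrt'
      ((hrw.reachable.trans hxy.reachable).trans hrw'.reachable.symm) j hj
  · rw [Nat.testBit_lt_two_pow ((hid _).trans_le (Nat.pow_le_pow_right (by simp) hj)),
      Nat.testBit_lt_two_pow ((hid _).trans_le (Nat.pow_le_pow_right (by simp) hj))]

theorem PhaseInv.strongDiam_le {w : V → ℕ} {lab : V → ℕ → ℕ} {core : V → NodeCore}
    (hid : ∀ v, N.id v < 2 ^ P.b) (h : PhaseInv P N w lab P.b core) {C : Set V}
    (hC : C ∈ clusters fun v => (core v).root) :
    strongDiam N.graph N.len C ≤ ((2 * P.radius P.b : ℕ) : ℝ≥0∞) :=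
  strongDiam_cluster_le N.id_injective (coreGraph_le core) (fun _ _ hxy => h.root_eq hid hxy)
    (fun v => (h.ruling.root v).imp fun _ hr => ⟨hr.1, hr.2.2⟩) hC

theorem ball_subset_cluster {w : V → ℕ} {lab : V → ℕ → ℕ} {core : V → NodeCore}
    (hid : ∀ v, N.id v < 2 ^ P.b)
    (hball : ∀ v u, u ∈ ball N.graph N.len v D → Within N.graph N.len P.d v u)
    (h : PhaseInv P N w lab P.b core) {v : V} (hv : (core v).bad = false) :
    ∃ C ∈ clusters (fun v => (core v).root), ball N.graph N.len v D ⊆ C :=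
  ⟨_, cluster_mem _ v, fun u hu => label_eq_of_reachable (fun _ _ hxy => h.root_eq hid hxy)
    ((h.ball v hv).within le_rfl (hball v u hu).symm).reachable⟩

/-- An unmarked vertex gains a padded round and a marked one a doubling, so the two counters
together keep up with `k`. Marked weight is at most `b / tries`, that is a tenth, of the total. -/
theorem ensures_round {k : ℕ} {c : V → NodeState} (hP : P.Valid) (hid : ∀ v, N.id v < 2 ^ P.b)
    (hball : ∀ v u, u ∈ ball N.graph N.len v D → Within N.graph N.len P.d v u) (hk : k < P.T)
    (h : RoundInv P N D k c) : Ensures N (RoundInv P N D (k + 1)) (P.round k) c := by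
  classical
  obtain ⟨β, hβ, hβk, hcount, hsum⟩ := h.exists_count
  have hw : ∀ v, 2 ^ β v < P.B := fun v =>
    (Nat.pow_lt_pow_right (by norm_num) ((hβk v).trans_lt hk)).trans_le hP.weight_le
  have hval : ∀ u, (P.word (c u).core.weight).val = 2 ^ β u := fun u => by
    rw [hβ, P.word_val (hw u)]
  have hstart : PhaseInv P N (fun v => 2 ^ β v) (fun v => (c v).core.label) 0
      fun v => ((c v).core).startRound (∑ u, (P.word (c u).core.weight).val) := by
    simp only [hval]
    exact phaseInv_start h.id h.nlen hβ fun _ => rfl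
  change Ensures N _ (loop P.b P.phase ++ [P.endStep k])
    fun v => { c v with core := ((c v).core).startRound (∑ u, (P.word (c u).core.weight).val) }
  rw [ensures_append]
  refine (ensures_loop (fun i c' => (∀ v, (c' v).done = false) ∧
    PhaseInv P N (fun v => 2 ^ β v) (fun v => (c v).core.label) i fun v => (c' v).core)
    (fun i hi c' hc' => ensures_phase hP hi hw hc') ⟨h.done, hstart⟩).mono ?_
  rintro c' ⟨hdone, hinv⟩
  change RoundInv P N D (k + 1) fun v => { c' v with core := (c' v).core.endRound k }
  have hlab_lt : ∀ i < k, (fun u => ((c' u).core.endRound k).label i) =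
      fun u => (c u).core.label i := fun i hi => funext fun u => by
    simp [NodeCore.endRound, hi.ne, hinv.label]
  have hlab_self : (fun u => ((c' u).core.endRound k).label k) = fun u => (c' u).core.root :=
    funext fun u => by simp [NodeCore.endRound]
  refine ⟨hinv.id, hinv.nlen, hdone, ⟨fun v => if (c' v).core.bad then β v + 1 else β v,
    fun v => ?_, fun v => ?_, fun v => ?_, ?_⟩, fun i hi C hC => ?_⟩
  · simp only [NodeCore.endRound, hinv.weight]
    split_ifs
    · rw [pow_succ']
    · rfl
  · have := hβk v
    dsimp only
    split_ifs <;> omega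
  · have hcongr : ((Finset.range k).filter fun i =>
        Padded N D (fun u => ((c' u).core.endRound k).label) i v) =
        (Finset.range k).filter fun i => Padded N D (fun u => (c u).core.label) i v := by
      refine Finset.filter_congr fun i hi => ?_
      rw [Padded, Padded, hlab_lt i (Finset.mem_range.1 hi)]
    have hv := hcount v
    dsimp only
    rw [Finset.range_add_one, Finset.filter_insert]
    by_cases hb : (c' v).core.bad = true
    · rw [if_pos hb]
      have : ((Finset.range k).filter fun i =>
          Padded N D (fun u => ((c' u).core.endRound k).label) i v).card ≤
          (if Padded N D (fun u => ((c' u).core.endRound k).label) k v then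
            insert k ((Finset.range k).filter fun i =>
              Padded N D (fun u => ((c' u).core.endRound k).label) i v) else
            (Finset.range k).filter fun i =>
              Padded N D (fun u => ((c' u).core.endRound k).label) i v).card := by
        split_ifs
        · exact Finset.card_le_card (Finset.subset_insert _ _)
        · exact le_rfl
      rw [hcongr] at this ⊢
      omega
    · have hp : Padded N D (fun u => ((c' u).core.endRound k).label) k v := by
        rw [Padded, hlab_self]
        exact ball_subset_cluster hid hball hinv (by simpa using hb)
      rw [if_neg hb, if_pos hp, Finset.card_insert_of_notMem (by simp), hcongr]
      omega
  · have h1 := hinv.bad_le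
    have h2 : 10 * ∑ v, (if (c' v).core.bad then 2 ^ β v else 0) ≤ ∑ v, 2 ^ β v := by
      refine Nat.le_of_mul_le_mul_left ?_ hP.b_pos
      calc _ = P.tries * ∑ v, (if (c' v).core.bad then 2 ^ β v else 0) := by
            rw [CoverParams.tries]; ring
        _ ≤ _ := h1
    have h3 : ∑ v, 2 ^ (if (c' v).core.bad then β v + 1 else β v) =
        ∑ v, 2 ^ β v + ∑ v, (if (c' v).core.bad then 2 ^ β v else 0) := by
      rw [← Finset.sum_add_distrib]
      refine Finset.sum_congr rfl fun v _ => ?_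
      split_ifs
      · rw [pow_succ']; ring
      · rfl
    rw [h3]
    calc _ = 10 ^ k * (10 * ∑ v, 2 ^ β v +
          10 * ∑ v, (if (c' v).core.bad then 2 ^ β v else 0)) := by ring
      _ ≤ 10 ^ k * (10 * ∑ v, 2 ^ β v + ∑ v, 2 ^ β v) := by gcongr
      _ = 11 * (10 ^ k * ∑ v, 2 ^ β v) := by ring
      _ ≤ 11 * (11 ^ k * Fintype.card V) := by gcongr
      _ = _ := by ring
  · rcases Nat.lt_succ_iff_lt_or_eq.1 hi with hi | rfl
    · dsimp only at hC
      rw [hlab_lt i hi] at hC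
      exact h.diam i hi C hC
    · dsimp only at hC
      rw [hlab_self] at hC
      exact hinv.strongDiam_le hid hC

/-- An exponent of `2 * L + 1` would force `2 * 4^L ≤ (2 * (11/10)^6)^L`, but `2 * 11^6 ≤ 4 * 10^6`.
-/
theorem count_le {β L n S : ℕ} (hn : n ≤ 2 ^ L) (hS : 10 ^ (6 * L) * S ≤ 11 ^ (6 * L) * n)
    (hβ : 2 ^ β ≤ S) : β ≤ 2 * L := by
  by_contra! h
  have h1 : 10 ^ (6 * L) * 2 ^ (2 * L + 1) ≤ 11 ^ (6 * L) * 2 ^ L :=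
    calc _ ≤ 10 ^ (6 * L) * S := by
          gcongr
          exact (Nat.pow_le_pow_right (by norm_num) h).trans hβ
      _ ≤ _ := hS
      _ ≤ _ := by gcongr
  rw [pow_succ, pow_mul, pow_mul, pow_mul, ← mul_assoc, ← mul_pow, ← mul_pow] at h1
  have h2 : (11 ^ 6 * 2) ^ L ≤ (10 ^ 6 * 2 ^ 2) ^ L := Nat.pow_le_pow_left (by norm_num) L
  have h3 : 0 < (10 ^ 6 * 2 ^ 2) ^ L := by positivity
  omega

theorem CoverParams.algorithm_solves {L : ℕ} {Δ : ℝ} (hP : P.Valid) (hT : P.T = 6 * L)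
    (hV : Fintype.card V ≤ 2 ^ L) (hid : ∀ v, N.id v < 2 ^ P.b)
    (hball : ∀ v u, u ∈ ball N.graph N.len v D → Within N.graph N.len P.d v u)
    (hΔ : ((2 * P.radius P.b : ℕ) : ℝ) ≤ Δ) :
    P.algorithm.Solves N fun label => IsSparseCover N.graph N.len D Δ label := by
  classical
  refine (ensures_loop (N := N) (body := P.round) (RoundInv P N D)
    (fun k hk c hc => ensures_round hP hid hball hk hc)
    ⟨fun _ => rfl, fun _ => rfl, fun _ => rfl, ⟨fun _ => 0, by simp [Algorithm.start, algorithm]⟩,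
      by simp⟩).mono fun c h => ⟨fun i C hC => ?_, fun v => ?_⟩
  · refine (h.diam i i.2 C hC).trans ?_
    rw [← ENNReal.ofReal_natCast]
    exact ENNReal.ofReal_le_ofReal hΔ
  · obtain ⟨β, -, -, hcount, hsum⟩ := h.exists_count
    have hβ : β v ≤ 2 * L := by
      refine count_le hV (by rwa [hT] at hsum) ?_
      exact Finset.single_le_sum (f := fun v => 2 ^ β v) (fun _ _ => Nat.zero_le _)
        (Finset.mem_univ v)
    have hcard : {i : Fin P.T | ∃ C ∈ clusters (fun u => (c u).core.label i),
        ball N.graph N.len v D ⊆ C}.ncard = ((Finset.range P.T).filter fun i =>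
        Padded N D (fun u => (c u).core.label) i v).card := by
      rw [← Set.ncard_image_of_injective _ Fin.val_injective, ← Set.ncard_coe_finset]
      congr 1
      ext i
      rw [Finset.mem_coe, Finset.mem_filter, Finset.mem_range]
      exact ⟨by rintro ⟨j, hj, rfl⟩; exact ⟨j.2, hj⟩, fun hi => ⟨⟨i, hi.1⟩, hi.2, rfl⟩⟩
    have := hcount v
    change 2 * P.T ≤ 3 * {i : Fin P.T | ∃ C ∈ clusters (fun u => (c u).core.label i),
        ball N.graph N.len v D ⊆ C}.ncard
    rw [hcard]
    omega

theorem CoverParams.length_steps (P : CoverParams) :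
    P.algorithm.steps.length = P.T * (P.b * (P.tries * 4 + 1) + 2) := by
  refine length_loop fun k => ?_
  simp only [CoverParams.round, List.length_cons, List.length_append, List.length_nil]
  rw [length_loop (m := P.tries * 4 + 1)]
  intro i
  simp only [CoverParams.phase, List.length_append, List.length_cons, List.length_nil]
  rw [length_loop (m := 4) fun _ => rfl]

theorem CoverParams.hasParams {R : ℝ} (P : CoverParams) (hd : 0 < P.d) (hdR : (P.d : ℝ) ≤ R)
    (hpos : ∀ i < P.b, 0 < P.radius (i + 1)) (hR : ∀ i < P.b, (P.radius (i + 1) : ℝ) ≤ R) :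
    ∀ I ∈ P.algorithm.steps, I.HasParams P.ε R := by
  change ∀ I : Instr NodeState P.B, I ∈ loop P.T P.round → I.HasParams P.ε R
  intro I hI
  obtain ⟨k, -, hI⟩ := mem_loop.1 hI
  simp only [CoverParams.round, List.mem_cons, List.mem_append, List.not_mem_nil, or_false] at hI
  rcases hI with rfl | hI | rfl
  · trivial
  · obtain ⟨i, hi, hI⟩ := mem_loop.1 hI
    simp only [CoverParams.phase, List.mem_append, List.mem_cons, List.not_mem_nil, or_false] at hI
    rcases hI with hI | rfl
    · obtain ⟨j, -, hI⟩ := mem_loop.1 hI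
      simp only [CoverParams.attempt, List.mem_cons, List.not_mem_nil, or_false] at hI
      rcases hI with rfl | rfl | rfl | rfl
      · exact ⟨rfl, by exact_mod_cast hpos i hi, hR i hi⟩
      · trivial
      · exact ⟨rfl, by exact_mod_cast hd, hdR⟩
      · trivial
    · trivial
  · trivial

end Rounds

/-! ### The choice of the parameters -/

section Parameters

/-- Bounds for the distances to the nearest terminals in the phases of a round. -/
def coverRadius (L b d : ℕ) : ℕ → ℕ
  | 0 => 0
  | i + 1 => coverRadius L b d i + 3 * (10 * b) * (128 * (coverRadius L b d i / L ^ 2 + d))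

/-- The quotient by `L ^ 2` pays for the oracle error, `d` for the width of the balls and for
rounding down. -/
def coverGap (L b d i : ℕ) : ℕ := 128 * (coverRadius L b d i / L ^ 2 + d)

theorem coverRadius_succ (L b d i : ℕ) :
    coverRadius L b d (i + 1) = coverRadius L b d i + 3 * (10 * b) * coverGap L b d i := rfl

theorem coverRadius_mono (L b d : ℕ) : Monotone (coverRadius L b d) :=
  monotone_nat_of_le_succ fun _ => Nat.le_add_right _ _

theorem exists_coverRadius_le (a : ℕ) : ∃ C, ∀ L d : ℕ, 0 < L →
    coverRadius L ((a + 1) * L) d ((a + 1) * L) ≤ C * (L ^ 2 * d) := by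
  obtain ⟨e, he⟩ : ∃ e, e = 3840 * (a + 1) ^ 2 := ⟨_, rfl⟩
  refine ⟨3 ^ e, fun L d hL => ?_⟩
  have hL' : (0 : ℝ) < L := by exact_mod_cast hL
  -- Adding `L ^ 2 * d` makes the affine recursion geometric; `3840 = 3 * 10 * 128`.
  have key : ∀ i, (coverRadius L ((a + 1) * L) d i : ℝ) + L ^ 2 * d ≤
      (1 + 3840 * (a + 1) / L) ^ i * (L ^ 2 * d) := by
    intro i
    induction i with
    | zero => simp [coverRadius]
    | succ i ih =>
      have hdiv : ((coverRadius L ((a + 1) * L) d i / L ^ 2 : ℕ) : ℝ) ≤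
          (coverRadius L ((a + 1) * L) d i : ℝ) / L ^ 2 := by
        rw [← Nat.cast_pow]
        exact Nat.cast_div_le
      rw [coverRadius_succ, coverGap, pow_succ' (1 + _) i]
      set r := coverRadius L ((a + 1) * L) d i
      push_cast
      calc (r : ℝ) + 3 * (10 * (((a : ℝ) + 1) * L)) * (128 * (((r / L ^ 2 : ℕ) : ℝ) + d)) + L ^ 2 * d
          ≤ (r : ℝ) + 3 * (10 * (((a : ℝ) + 1) * L)) * (128 * ((r : ℝ) / L ^ 2 + d)) + L ^ 2 * d := by
            gcongr
        _ = (1 + 3840 * ((a : ℝ) + 1) / L) * (r + L ^ 2 * d) := by field_simp; ring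
        _ ≤ (1 + 3840 * ((a : ℝ) + 1) / L) * ((1 + 3840 * ((a : ℝ) + 1) / L) ^ i * (L ^ 2 * d)) := by gcongr
        _ = _ := by ring
  have hexp : (1 + 3840 * ((a : ℝ) + 1) / L) ^ ((a + 1) * L) ≤ 3 ^ e := by
    calc (1 + 3840 * ((a : ℝ) + 1) / L) ^ ((a + 1) * L)
        ≤ (Real.exp (3840 * (a + 1) / L)) ^ ((a + 1) * L) := by
          gcongr
          rw [add_comm]
          exact Real.add_one_le_exp _
      _ = Real.exp 1 ^ e := by
          rw [he, ← Real.exp_nat_mul, ← Real.exp_nat_mul]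
          congr 1
          push_cast
          field_simp
      _ ≤ 3 ^ e := by
          gcongr
          exact Real.exp_one_lt_three.le
  have h : (coverRadius L ((a + 1) * L) d ((a + 1) * L) : ℝ) ≤
      3 ^ e * (L ^ 2 * d) := by
    refine le_trans ?_ ((key _).trans (mul_le_mul_of_nonneg_right hexp (by positivity)))
    exact le_add_of_nonneg_right (by positivity)
  exact_mod_cast h

/-- The parameters for `n` vertices, `L ≈ log n`, and identifiers below `n ^ a`. -/
def coverParams (a L B d : ℕ) (hB : 0 < B) (ε : ℝ) : CoverParams where
  B := B
  B_pos := hB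
  b := (a + 1) * L
  T := 6 * L
  d := d
  ε := ε
  gap := coverGap L ((a + 1) * L) d
  radius := coverRadius L ((a + 1) * L) d

theorem coverParams_valid {a L B d : ℕ} (hB : 0 < B) {ε : ℝ} (hL : 480 * (a + 1) ≤ L) (hd : 0 < d)
    (h3 : 3 ≤ B) (hε : 0 ≤ ε) (hε1 : ε ≤ 1) (hεL : ε * L ^ 2 ≤ 4)
    (hBr : coverRadius L ((a + 1) * L) d ((a + 1) * L) < B) (hBw : 2 ^ (6 * L) ≤ B) :
    (coverParams a L B d hB ε).Valid := by
  have hL0 : 0 < L := by omega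
  have hLr : (0 : ℝ) < L := by exact_mod_cast hL0
  have hb : 0 < (a + 1) * L := by positivity
  have hdr : (1 : ℝ) ≤ d := by exact_mod_cast hd
  have hεr : ∀ i, ε * (coverRadius L ((a + 1) * L) d i : ℝ) ≤
      4 * (((coverRadius L ((a + 1) * L) d i / L ^ 2 : ℕ) : ℝ) + d) := by
    intro i
    set r := coverRadius L ((a + 1) * L) d i
    have h1 : r < L ^ 2 * (r / L ^ 2 + 1) := Nat.lt_mul_div_succ r (by positivity)
    have h2 : (r : ℝ) ≤ L ^ 2 * (((r / L ^ 2 : ℕ) : ℝ) + d) := by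
      have : (r : ℝ) ≤ L ^ 2 * (((r / L ^ 2 : ℕ) : ℝ) + 1) := by exact_mod_cast h1.le
      refine this.trans ?_
      gcongr
    calc ε * (r : ℝ) ≤ ε * (L ^ 2 * (((r / L ^ 2 : ℕ) : ℝ) + d)) := by gcongr
      _ = ε * L ^ 2 * (((r / L ^ 2 : ℕ) : ℝ) + d) := by ring
      _ ≤ _ := by gcongr
  refine ⟨h3, hb, hε, hε1, fun i _ => ?_, fun i _ => ?_, fun i hi => ?_, hBw⟩
  · change (1 + ε) * ((coverRadius L ((a + 1) * L) d i +
      10 * ((a + 1) * L) * coverGap L ((a + 1) * L) d i : ℕ) : ℝ) ≤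
      (coverRadius L ((a + 1) * L) d (i + 1) : ℕ)
    have h := hεr i
    rw [coverRadius_succ]
    have hg : (coverGap L ((a + 1) * L) d i : ℝ) =
        128 * (((coverRadius L ((a + 1) * L) d i / L ^ 2 : ℕ) : ℝ) + d) := by
      simp [coverGap]
    obtain ⟨m, hm⟩ : ∃ m, m = 10 * ((a + 1) * L) := ⟨_, rfl⟩
    have hm1 : (1 : ℝ) ≤ m := by exact_mod_cast (by omega)
    rw [← hm]
    push_cast
    generalize (coverGap L ((a + 1) * L) d i : ℝ) = g at *
    generalize (coverRadius L ((a + 1) * L) d i : ℝ) = r at *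
    have hq : (0 : ℝ) ≤ ((coverRadius L ((a + 1) * L) d i / L ^ 2 : ℕ) : ℝ) := by positivity
    have hg0 : 0 ≤ g := by rw [hg]; positivity
    have h1 : ε * (m * g) ≤ m * g := mul_le_of_le_one_left (by positivity) hε1
    have h2 : g ≤ m * g := le_mul_of_one_le_left hg0 hm1
    nlinarith
  · change 6 * ε * ((coverRadius L ((a + 1) * L) d i +
      10 * ((a + 1) * L) * coverGap L ((a + 1) * L) d i : ℕ) : ℝ) + 36 * (d : ℝ) <
      (coverGap L ((a + 1) * L) d i : ℕ)
    have h := hεr i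
    have hg : (coverGap L ((a + 1) * L) d i : ℝ) =
        128 * (((coverRadius L ((a + 1) * L) d i / L ^ 2 : ℕ) : ℝ) + d) := by
      simp [coverGap]
    -- `ε * L ^ 2 ≤ 4` and `480 * (a + 1) ≤ L` give `40 / 480`. So the delays contribute at most
    -- half a gap to the window, and `24 * (q + d) + 36 * d`, with `q` the quotient in the gap, fits
    -- into the other half.
    have hm : ε * ((10 * ((a + 1) * L) : ℕ) : ℝ) ≤ 1 / 12 := by
      have hLa : 480 * ((a : ℝ) + 1) ≤ L := by exact_mod_cast hL
      have h1 : ε * L * (480 * ((a : ℝ) + 1)) ≤ ε * L * L := by gcongr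
      push_cast
      nlinarith
    rw [Nat.cast_add, Nat.cast_mul]
    generalize ((10 * ((a + 1) * L) : ℕ) : ℝ) = m at *
    have hq : (0 : ℝ) ≤ ((coverRadius L ((a + 1) * L) d i / L ^ 2 : ℕ) : ℝ) := by positivity
    have h1 : ε * m * (coverGap L ((a + 1) * L) d i : ℝ) ≤
        1 / 12 * (coverGap L ((a + 1) * L) d i : ℝ) := by gcongr
    generalize (coverGap L ((a + 1) * L) d i : ℝ) = g at *
    nlinarith
  · change 10 * ((a + 1) * L) * coverGap L ((a + 1) * L) d i < B
    have h1 : coverRadius L ((a + 1) * L) d (i + 1) ≤ _ :=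
      coverRadius_mono L ((a + 1) * L) d (show i + 1 ≤ (a + 1) * L from hi)
    rw [coverRadius_succ] at h1
    rw [mul_assoc 3] at h1
    omega

variable {n : ℕ}

theorem one_le_logb (hn : 2 ≤ n) : 1 ≤ Real.logb 2 n := by
  rw [Real.le_logb_iff_rpow_le (by norm_num) (by positivity)]
  simpa using (show (2 : ℝ) ≤ n by exact_mod_cast hn)

theorem two_pow_clog_le (hn : 2 ≤ n) : 2 ^ Nat.clog 2 n ≤ 2 * n := by
  have h := Nat.pow_pred_clog_lt_self (b := 2) (by norm_num) (x := n) (by omega)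
  have h1 : 0 < Nat.clog 2 n := Nat.clog_pos (by norm_num) hn
  obtain ⟨k, hk⟩ := Nat.exists_eq_succ_of_ne_zero h1.ne'
  rw [hk] at h ⊢
  rw [Nat.pred_succ] at h
  rw [Nat.pow_succ]
  omega

theorem clog_le_two_mul_logb (hn : 2 ≤ n) : (Nat.clog 2 n : ℝ) ≤ 2 * Real.logb 2 n := by
  have h1 : (Nat.clog 2 n : ℝ) ≤ Real.logb 2 (2 * n) := by
    rw [Real.le_logb_iff_rpow_le (by norm_num) (by positivity), Real.rpow_natCast]
    exact_mod_cast two_pow_clog_le hn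
  rw [Real.logb_mul (by norm_num) (by positivity), Real.logb_self_eq_one (by norm_num)] at h1
  linarith [one_le_logb hn]

theorem clog_le_self (n : ℕ) : Nat.clog 2 n ≤ n :=
  Nat.clog_le_of_le_pow Nat.lt_two_pow_self.le

theorem exists_clog_bound (k : ℕ) : ∃ M : ℕ, 0 < M ∧ ∀ n, Nat.clog 2 n ≤ k → n ≤ M :=
  ⟨2 ^ k, by positivity, fun n h =>
    (Nat.le_pow_clog (by norm_num) n).trans (Nat.pow_le_pow_right (by norm_num) h)⟩

end Parameters

/-- Partitions, algorithm and bounds for given `n` and `D`, as in the main theorem. -/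
def IsCoverAlgorithm (a n : ℕ) (D K : ℝ) {B : ℕ} (A : Algorithm B) : Prop :=
  (A.steps.length : ℝ) ≤ K * Real.logb 2 n ^ 4 ∧
  (∀ I ∈ A.steps, I.HasParams (1 / Real.logb 2 n ^ 2) (K * Real.logb 2 n ^ 3 * D)) ∧
  1 ≤ A.t ∧ (A.t : ℝ) ≤ K * Real.logb 2 n ∧
  ∀ (V : Type) [Fintype V] (N : Network V), Fintype.card V = n → N.PolyBounded n a →
    A.Solves N fun label => IsSparseCover N.graph N.len D (K * D * Real.logb 2 n ^ 3) label

/-! ### Assembly: the degenerate cases and the main case -/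

section Main

variable {a n : ℕ} {D : ℝ}

theorem id_lt_two_pow {V : Type*} {N : Network V} (hN : N.PolyBounded n a) (v : V) :
    N.id v < 2 ^ ((a + 1) * Nat.clog 2 n) := by
  refine (hN.id_lt v).trans_le ?_
  calc n ^ a ≤ (2 ^ Nat.clog 2 n) ^ a := Nat.pow_le_pow_left (Nat.le_pow_clog (by norm_num) n) a
    _ = 2 ^ (a * Nat.clog 2 n) := by rw [← pow_mul, mul_comm]
    _ ≤ _ := Nat.pow_le_pow_right (by norm_num) (Nat.mul_le_mul_right _ (Nat.le_succ a))

/-- Connected vertices are at most `n * n ^ a` apart, so the radius can be capped there; this keeps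
the delays polynomial in `n` for every `D`. -/
theorem within_of_mem_ball {V : Type*} [Fintype V] {N : Network V} (hV : Fintype.card V = n)
    (hN : N.PolyBounded n a) (hD : 0 ≤ D) {u v : V} (h : u ∈ ball N.graph N.len v D) :
    Within N.graph N.len (min ⌊D⌋₊ (n ^ (a + 1))) v u := by
  have h1 := (mem_ball_iff hD).1 h
  rcases min_choice ⌊D⌋₊ (n ^ (a + 1)) with h2 | h2
  · rwa [h2]
  · rw [h2, pow_succ', ← hV]
    refine Within.of_reachable (fun x y hxy => ?_) h1.reachable
    rw [hV]
    exact hN.len_le x y hxy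

/-- If `D < 1`, only edges of length 0 are kept and components have diameter 0; if `n ≤ M`, the
factor `n` in the diameter is a constant. -/
theorem isCoverAlgorithm_comp {K : ℝ} {B : ℕ} (hB : 0 < B) (hn : 2 ≤ n) (hD : 0 < D)
    {M : ℕ} (hM : 0 < M)
    (hsmall : D < 1 ∨ n ≤ M) (hK1 : 2 * a + 3 ≤ K) (hK2 : 2 * M ≤ K) :
    IsCoverAlgorithm a n D K (compAlgorithm hB (1 / Real.logb 2 n ^ 2)
      (M * D) ⌊D⌋₊ ((a + 1) * Nat.clog 2 n)) := by
  have hl := one_le_logb hn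
  have hl3 : 1 ≤ Real.logb 2 n ^ 3 := one_le_pow₀ hl
  have hK0 : 0 ≤ K := le_trans (by positivity) hK1
  have hcard : (n * ⌊D⌋₊ : ℝ) ≤ M * D := by
    rcases hsmall with h | h
    · rw [Nat.floor_eq_zero.2 h]
      simp only [Nat.cast_zero, mul_zero]
      positivity
    · gcongr
      exact Nat.floor_le hD.le
  have hKD : 2 * (M * D) ≤ K * D * Real.logb 2 n ^ 3 := by
    calc 2 * (M * D) = 2 * M * D := by ring
      _ ≤ K * D := by gcongr
      _ ≤ _ := le_mul_of_one_le_right (by positivity) hl3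
  have hpos : 0 < M * D := by positivity
  refine ⟨?_, ?_, le_rfl, ?_, fun V _ N hV hN => ?_⟩
  · have hlen : (compAlgorithm hB (1 / Real.logb 2 n ^ 2) (M * D) ⌊D⌋₊
        ((a + 1) * Nat.clog 2 n)).steps.length = (a + 1) * Nat.clog 2 n * 1 + 1 := by
      simp only [compAlgorithm, List.length_append, List.length_cons, List.length_nil]
      rw [length_loop (m := 1) fun _ => rfl]
    rw [hlen]
    have h1 := clog_le_two_mul_logb hn
    have h4 : Real.logb 2 n ≤ Real.logb 2 n ^ 4 := le_self_pow₀ hl (by norm_num)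
    push_cast
    calc ((a : ℝ) + 1) * Nat.clog 2 n * 1 + 1 ≤
        (a + 1) * (2 * Real.logb 2 n) * 1 + Real.logb 2 n := by gcongr
      _ = (2 * a + 3) * Real.logb 2 n := by ring
      _ ≤ K * Real.logb 2 n ^ 4 := by gcongr
  · have hR : M * D ≤ K * Real.logb 2 n ^ 3 * D := by
      linarith [hKD, mul_right_comm K (Real.logb 2 n ^ 3) D]
    change ∀ I : Instr CompState B, I ∈ loop _ _ ++ [_] → _
    intro I hI
    rcases List.mem_append.1 hI with hI | hI
    · obtain ⟨i, -, hI⟩ := mem_loop.1 hI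
      obtain rfl := List.mem_singleton.1 hI
      exact ⟨rfl, hpos, hR⟩
    · obtain rfl := List.mem_singleton.1 hI
      exact ⟨rfl, hpos, hR⟩
  · change ((1 : ℕ) : ℝ) ≤ K * Real.logb 2 n
    have : (1 : ℝ) ≤ K := le_trans (by linarith [(Nat.cast_nonneg a : (0 : ℝ) ≤ a)]) hK1
    rw [Nat.cast_one]
    exact one_le_mul_of_one_le_of_one_le this hl
  · refine compAlgorithm_solves hD.le (by positivity) (id_lt_two_pow hN) ?_ ?_
    · rw [hV]
      exact_mod_cast hcard
    · rw [hV]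
      push_cast
      linarith

theorem isCoverAlgorithm_cover {K : ℝ} {C κ : ℕ} (hn : 2 ≤ n) (hD : 1 ≤ D)
    (hL : 480 * (a + 1) ≤ Nat.clog 2 n) (hC1 : 1 ≤ C)
    (hC : ∀ L d : ℕ, 0 < L → coverRadius L ((a + 1) * L) d ((a + 1) * L) ≤ C * (L ^ 2 * d))
    (hκ : C + a + 12 ≤ κ) (hB : 0 < n ^ κ)
    (hK1 : 2064 * ((a : ℝ) + 1) ^ 2 ≤ K) (hK2 : 8 * (C : ℝ) ≤ K) :
    IsCoverAlgorithm a n D K (coverParams a (Nat.clog 2 n) (n ^ κ) (min ⌊D⌋₊ (n ^ (a + 1))) hB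
      (1 / Real.logb 2 n ^ 2)).algorithm := by
  set L := Nat.clog 2 n
  set d := min ⌊D⌋₊ (n ^ (a + 1))
  have hl := one_le_logb hn
  have hLl : (L : ℝ) ≤ 2 * Real.logb 2 n := clog_le_two_mul_logb hn
  set ℓ := Real.logb 2 n
  have hL0 : 0 < L := by omega
  have hL1 : (1 : ℝ) ≤ L := by exact_mod_cast hL0
  have hC1' : (1 : ℝ) ≤ C := by exact_mod_cast hC1
  have hd : 0 < d := lt_min (Nat.floor_pos.2 hD) (by positivity)
  have hdD : (d : ℝ) ≤ D := le_trans (by exact_mod_cast min_le_left _ _) (Nat.floor_le (by linarith))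
  have hr := hC L d hL0
  have hrD : (coverRadius L ((a + 1) * L) d ((a + 1) * L) : ℝ) ≤ 4 * C * D * ℓ ^ 3 := by
    calc (coverRadius L ((a + 1) * L) d ((a + 1) * L) : ℝ) ≤ C * (L ^ 2 * d) := by exact_mod_cast hr
      _ ≤ C * ((2 * ℓ) ^ 2 * D) := by gcongr
      _ = 4 * C * D * ℓ ^ 2 := by ring
      _ ≤ 4 * C * D * ℓ ^ 3 := by
        gcongr
        norm_num
  have hvalid : (coverParams a L (n ^ κ) d hB (1 / ℓ ^ 2)).Valid := by
    refine coverParams_valid hB hL hd ?_ (by positivity) ?_ ?_ ?_ ?_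
    · calc 3 ≤ 2 ^ 2 := by norm_num
        _ ≤ n ^ 2 := Nat.pow_le_pow_left hn 2
        _ ≤ n ^ κ := Nat.pow_le_pow_right (by omega) (by omega)
    · rw [div_le_one (by positivity)]
      exact one_le_pow₀ hl
    · rw [div_mul_eq_mul_div, one_mul, div_le_iff₀ (by positivity)]
      calc (L : ℝ) ^ 2 ≤ (2 * ℓ) ^ 2 := by gcongr
        _ = 4 * ℓ ^ 2 := by ring
    · have h1 : C ≤ n ^ C := Nat.lt_two_pow_self.le.trans (Nat.pow_le_pow_left hn _)
      have h2 : L ^ 2 ≤ n ^ 2 := Nat.pow_le_pow_left (clog_le_self n) 2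
      have h3 : d ≤ n ^ (a + 1) := min_le_right _ _
      calc coverRadius L ((a + 1) * L) d ((a + 1) * L) ≤ C * (L ^ 2 * d) := hr
        _ ≤ n ^ C * (n ^ 2 * n ^ (a + 1)) := by gcongr
        _ = n ^ (C + (2 + (a + 1))) := by rw [← pow_add, ← pow_add]
        _ < n ^ κ := Nat.pow_lt_pow_right (by omega) (by omega)
    · calc 2 ^ (6 * L) = (2 ^ L) ^ 6 := by rw [mul_comm, pow_mul]
        _ ≤ (n * n) ^ 6 := by
          refine Nat.pow_le_pow_left ((two_pow_clog_le hn).trans ?_) 6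
          gcongr
        _ = n ^ 12 := by ring
        _ ≤ n ^ κ := Nat.pow_le_pow_right (by omega) (by omega)
  refine ⟨?_, ?_, ?_, ?_, fun V _ N hV hN => ?_⟩
  · rw [CoverParams.length_steps]
    change ((6 * L * ((a + 1) * L * (10 * ((a + 1) * L) * 4 + 1) + 2) : ℕ) : ℝ) ≤ _
    have ha : (0 : ℝ) ≤ a := by positivity
    have hsq : (1 : ℝ) ≤ (a + 1) ^ 2 := one_le_pow₀ (by linarith)
    push_cast
    -- `258 = 6 * (40 + 1 + 2)`, and `L ≤ 2 * ℓ` turns it into `2064`. The count is cubic in `ℓ`, so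
    -- one factor `ℓ` is spare.
    calc 6 * (L : ℝ) * ((a + 1) * L * (10 * ((a + 1) * L) * 4 + 1) + 2)
        ≤ 6 * (L : ℝ) * ((a + 1) * L * (10 * ((a + 1) * L) * 4 + (a + 1) * L) +
          2 * ((a + 1) * L) ^ 2) := by
          have h1 : (1 : ℝ) ≤ (a + 1) * L := one_le_mul_of_one_le_of_one_le (by linarith) hL1
          have h2 : (1 : ℝ) ≤ ((a + 1) * L) ^ 2 := one_le_pow₀ h1
          gcongr
          linarith
      _ = 258 * (a + 1) ^ 2 * L ^ 3 := by ring
      _ ≤ 258 * (a + 1) ^ 2 * (2 * ℓ) ^ 3 := by gcongr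
      _ = 2064 * (a + 1) ^ 2 * ℓ ^ 3 := by ring
      _ ≤ K * ℓ ^ 4 := by
        gcongr
        · exact le_trans (by positivity) hK1
        · norm_num
  · have hbound : 4 * C * D * ℓ ^ 3 ≤ K * ℓ ^ 3 * D := by
      calc 4 * C * D * ℓ ^ 3 = 4 * C * ℓ ^ 3 * D := by ring
        _ ≤ K * ℓ ^ 3 * D := by gcongr; linarith
    refine CoverParams.hasParams _ hd ?_ (fun i _ => ?_) (fun i hi => ?_)
    · calc (d : ℝ) ≤ D := hdD
        _ = 1 * 1 * D * 1 ^ 3 := by ring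
        _ ≤ 4 * C * D * ℓ ^ 3 := by
          gcongr
          norm_num
        _ ≤ _ := hbound
    · change 0 < coverRadius L ((a + 1) * L) d (i + 1)
      rw [coverRadius_succ, coverGap]
      positivity
    · refine le_trans ?_ (hrD.trans hbound)
      exact_mod_cast coverRadius_mono L ((a + 1) * L) d (show i + 1 ≤ (a + 1) * L from hi)
  · change 1 ≤ 6 * L
    omega
  · change ((6 * L : ℕ) : ℝ) ≤ K * ℓ
    push_cast
    calc 6 * (L : ℝ) ≤ 6 * (2 * ℓ) := by gcongr
      _ = 12 * ℓ := by ring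
      _ ≤ K * ℓ := by
        gcongr
        nlinarith [(Nat.cast_nonneg a : (0 : ℝ) ≤ a)]
  · refine CoverParams.algorithm_solves hvalid rfl (hV ▸ Nat.le_pow_clog (by norm_num) n)
      (id_lt_two_pow hN) (fun v u hu => within_of_mem_ball hV hN (by linarith) hu) ?_
    change ((2 * coverRadius L ((a + 1) * L) d ((a + 1) * L) : ℕ) : ℝ) ≤ _
    push_cast
    calc 2 * (coverRadius L ((a + 1) * L) d ((a + 1) * L) : ℝ) ≤ 2 * (4 * C * D * ℓ ^ 3) := by
          gcongr
      _ = 8 * C * D * ℓ ^ 3 := by ring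
      _ ≤ K * D * ℓ ^ 3 := by gcongr

theorem exists_coverAlgorithm (a : ℕ) : ∃ (K : ℝ) (κ : ℕ), ∀ (n : ℕ) (D : ℝ), 2 ≤ n → 0 < D →
    ∃ A : Algorithm (n ^ κ), IsCoverAlgorithm a n D K A := by
  obtain ⟨C, hC⟩ := exists_coverRadius_le a
  obtain ⟨M, hM0, hM⟩ := exists_clog_bound (480 * (a + 1))
  refine ⟨2064 * ((a : ℝ) + 1) ^ 2 + 8 * (C + 1 : ℕ) + 2 * M, C + 1 + a + 12, fun n D hn hD => ?_⟩
  have ha : (0 : ℝ) ≤ a := by positivity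
  have hM' : (0 : ℝ) ≤ M := by positivity
  have hC0 : (0 : ℝ) ≤ (C + 1 : ℕ) := by positivity
  have hB : 0 < n ^ (C + 1 + a + 12) := Nat.pow_pos (by omega)
  by_cases hsmall : D < 1 ∨ n ≤ M
  · exact ⟨_, isCoverAlgorithm_comp hB hn hD hM0 hsmall (by nlinarith) (by nlinarith)⟩
  · push Not at hsmall
    refine ⟨_, isCoverAlgorithm_cover (C := C + 1) hn hsmall.1 ?_ (by omega)
      (fun L d hL => (hC L d hL).trans (Nat.mul_le_mul_right _ (Nat.le_succ C))) le_rfl hB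
      (by linarith) (by nlinarith)⟩
    by_contra! h
    exact absurd hsmall.2 (not_lt.2 (hM n h.le))

end Main

end SparseCover

end

theorem mainTheorem4 (a : ℕ) :
    ∃ (K : ℝ) (κ : ℕ) (A : (n : ℕ) → (D : ℝ) → SparseCover.Algorithm (n ^ κ)),
      ∀ (n : ℕ) (D : ℝ), 2 ≤ n → 0 < D →
        ((A n D).steps.length : ℝ) ≤ K * Real.logb 2 n ^ 4 ∧
        (∀ I ∈ (A n D).steps,
          I.HasParams (1 / Real.logb 2 n ^ 2) (K * Real.logb 2 n ^ 3 * D)) ∧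
        1 ≤ (A n D).t ∧ ((A n D).t : ℝ) ≤ K * Real.logb 2 n ∧
        ∀ (V : Type) [Fintype V] (N : SparseCover.Network V),
          Fintype.card V = n → N.PolyBounded n a →
          (A n D).Solves N fun label =>
            SparseCover.IsSparseCover N.graph N.len D (K * D * Real.logb 2 n ^ 3) label := by
  obtain ⟨K, κ, h⟩ := SparseCover.exists_coverAlgorithm a
  have h' : ∀ (n : ℕ) (D : ℝ), ∃ A : SparseCover.Algorithm (n ^ κ), 2 ≤ n → 0 < D →
      SparseCover.IsCoverAlgorithm a n D K A := by
    intro n D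
    by_cases hnD : 2 ≤ n ∧ 0 < D
    · exact (h n D hnD.1 hnD.2).imp fun _ hA _ _ => hA
    -- A dummy algorithm outside the range of the theorem, so that a choice function exists.
    · exact ⟨⟨Unit, fun _ _ => (), [], 0, fun _ _ => 0⟩, fun h1 h2 => absurd ⟨h1, h2⟩ hnD⟩
  choose A hA using h'
  exact ⟨K, κ, A, hA⟩
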